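/- Let $\alpha>0$, and let $F:\mathbb R^2\to\mathbb R$ be Lipschitz continuous with compact support $\Sigma:=\operatorname{supp}F$. Let $R_\varnothing(z)=(-\Delta-z)^{-1}$, $z\in\mathbb C\setminus[0,+\infty)$, be the resolvent of the free Laplacian in $L^2(\mathbb R^3)$ with domain $H^2(\mathbb R^3)$. For every $r>0$ the evaluation maps $\varphi\mapsto\varphi(F(\cdot),\cdot)$ and $\varphi\mapsto\varphi(0,\cdot)$ on smooth compactly supported functions on $\mathbb R^3$ have unique continuous extensions $\tau_F,\tau_0:H^{r+1/2}(\mathbb R^3)\to L^2(\mathbb R^2)$. For $F'\in\{F,0\}$ and $z\in\mathbb C\setminus[0,+\infty)$ put $$\breve G_{F'}(z):=\tau_{F'}R_\varnothing(z),\qquad G_{F'}(z):=\breve G_{F'}(\bar z)^*,\qquad \Gamma_{F'}(z):=1+\alpha\,\tau_{F'}G_{F'}(z)\ \text{ in } L^2(\mathbb R^2),$$ $$R_{F'}(z):=R_\varnothing(z)-\alpha\,G_{F'}(z)\,\Gamma_{F'}(z)^{-1}\,\breve G_{F'}(z)$$ (the resolvent of $-\Delta$ with a $\delta$-interaction of strength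 $\alpha$ on the graph $\{x^1=F'(x_\parallel)\}$). Here $G_{F'}(z)$ is bounded from $L^2(\mathbb R^2)$ into $H^1(\mathbb R^3)$, and $\Gamma_{F'}(z)$ has a bounded inverse in $L^2(\mathbb R^2)$. Let $\tau_\Sigma f:=(\tau_Ff|_\Sigma)\oplus(\tau_0f|_\Sigma)$, as a map $\tau_\Sigma:H^{r+1/2}(\mathbb R^3)\to L^2(\Sigma)\oplus L^2(\Sigma)$, $r>0$. Then the resolvent difference is expressed through $R_0$ and the restrictions to $\Sigma$ of the traces $\tau_F$, $\tau_0$ alone: for every $z\in\mathbb C\setminus[0,+\infty)$, $$R_F(z)-R_0(z)=g_\Sigma(z)\,\Lambda_{F,\Sigma}(z)\,\breve g_\Sigma(z),$$ where $$\breve g_\Sigma(z):=\tau_\Sigma R_0(z):L^2(\mathbb R^3)\to L^2(\Sigma)\oplus L^2(\Sigma),\qquad g_\Sigma(z):=\breve g_\Sigma(\bar z)^*:L^2(\Sigma)\oplus L^2(\Sigma)\to L^2(\mathbb R^3),$$ $$\Lambda_{F,\Sigma}(z):=-\alpha\,\bigl(1+\alpha J\,\tau_\Sigma g_\Sigma(z)\bigr)^{-1}J,\qquad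 J=\begin{pmatrix}1&0\\0&-1\end{pmatrix}.$$ For every $r\in(0,1)$, $R_0(z)$ and $g_\Sigma(z)$ are bounded into $H^{r+1/2}(\mathbb R^3)$, so that $\tau_\Sigma$ on $H^{r+1/2}(\mathbb R^3)$ can be applied after them, and the operator $1+\alpha J\tau_\Sigma g_\Sigma(z)$ has a bounded inverse in $L^2(\Sigma)\oplus L^2(\Sigma)$. -/

import Mathlib

open MeasureTheory TemperedDistribution
open scoped SchwartzMap Laplacian ComplexConjugate

noncomputable section

namespace DeltaPlane

/-- The space `ℝ^k` with its Euclidean structure. -/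
abbrev Euc (k : ℕ) : Type := EuclideanSpace ℝ (Fin k)

/-- The Hilbert space `L²(ℝ^k)` of complex square-integrable functions. -/
abbrev L2 (k : ℕ) : Type := Lp ℂ 2 (volume : Measure (Euc k))

/-- The Hilbert space `L²(Σ)` for a set `Σ ⊆ ℝ^k`. -/
abbrev L2On {k : ℕ} (S : Set (Euc k)) : Type :=
  Lp ℂ 2 ((volume : Measure (Euc k)).restrict S)

/-- An `L²` function, as a distribution. -/
def distr (k : ℕ) : L2 k →ₗ[ℂ] 𝓢'(Euc k, ℂ) :=
  (Lp.toTemperedDistributionCLM ℂ (volume : Measure (Euc k)) 2).toLinearMap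

theorem distr_injective (k : ℕ) : Function.Injective (distr k) :=
  LinearMap.ker_eq_bot.mp
    (Lp.ker_toTemperedDistributionCLM_eq_bot (F := ℂ) (μ := (volume : Measure (Euc k))) (p := 2))

/-- A linear map with values in the distributions that are given by `L²` functions, as a linear map
into `L²`. -/
def liftL2 {M : Type} [AddCommGroup M] [Module ℂ M] {k : ℕ} (L : M →ₗ[ℂ] 𝓢'(Euc k, ℂ))
    (h : ∀ m, L m ∈ LinearMap.range (distr k)) : M →ₗ[ℂ] L2 k :=
  (LinearEquiv.ofInjective (distr k) (distr_injective k)).symm.toLinearMap ∘ₗ L.codRestrict _ h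

theorem distr_liftL2 {M : Type} [AddCommGroup M] [Module ℂ M] {k : ℕ}
    (L : M →ₗ[ℂ] 𝓢'(Euc k, ℂ)) (h : ∀ m, L m ∈ LinearMap.range (distr k)) (m : M) :
    distr k (liftL2 L h m) = L m :=
  congrArg Subtype.val
    ((LinearEquiv.ofInjective (distr k) (distr_injective k)).apply_symm_apply
      (L.codRestrict _ h m))

/-! ### Sobolev spaces -/

/-- The distributions that belong to `H^s(ℝ^k)`. -/
def sobolevSubmodule (k : ℕ) (s : ℝ) : Submodule ℂ 𝓢'(Euc k, ℂ) where
  carrier := {u | MemSobolev s 2 u}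
  add_mem' := fun hu hv => MemSobolev.add hu hv
  zero_mem' := memSobolev_fun_zero (Euc k) ℂ s 2
  smul_mem' := fun c _ hu => MemSobolev.smul c hu

/-- The Sobolev space `H^s(ℝ^k)`, for any real order `s`. -/
def Sobolev (k : ℕ) (s : ℝ) : Type := ↥(sobolevSubmodule k s)

namespace Sobolev

variable {k : ℕ} {s : ℝ}

instance : AddCommGroup (Sobolev k s) := inferInstanceAs (AddCommGroup ↥(sobolevSubmodule k s))

instance : Module ℂ (Sobolev k s) := inferInstanceAs (Module ℂ ↥(sobolevSubmodule k s))

/-- An element of `H^s(ℝ^k)`, as a distribution. -/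
def toDistribution : Sobolev k s →ₗ[ℂ] 𝓢'(Euc k, ℂ) := (sobolevSubmodule k s).subtype

theorem toDistribution_injective :
    Function.Injective (toDistribution : Sobolev k s →ₗ[ℂ] 𝓢'(Euc k, ℂ)) :=
  Subtype.val_injective

theorem bessel_mem_range (u : Sobolev k s) :
    ((besselPotential (Euc k) ℂ s).toLinearMap ∘ₗ toDistribution) u ∈ LinearMap.range (distr k) := by
  obtain ⟨g, hg⟩ := u.2
  exact ⟨g, hg.symm⟩

/-- The `L²` function obtained from an element of `H^s(ℝ^k)` by applying the Bessel potential
operator `(1 - (2π)⁻² Δ)^(s/2)`. -/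
def bessel : Sobolev k s →ₗ[ℂ] L2 k :=
  liftL2 ((besselPotential (Euc k) ℂ s).toLinearMap ∘ₗ toDistribution) bessel_mem_range

theorem distr_bessel (u : Sobolev k s) :
    distr k (bessel u) = besselPotential (Euc k) ℂ s (toDistribution u) :=
  distr_liftL2 _ _ u

theorem bessel_injective : Function.Injective (bessel : Sobolev k s →ₗ[ℂ] L2 k) := by
  intro u v huv
  apply toDistribution_injective
  have h : besselPotential (Euc k) ℂ s (toDistribution u)
      = besselPotential (Euc k) ℂ s (toDistribution v) := by
    rw [← distr_bessel, ← distr_bessel, huv]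
  have h2 := congrArg (besselPotential (Euc k) ℂ (-s)) h
  simpa using h2

/-- The norm of `H^s(ℝ^k)`, namely `‖(1 - (2π)⁻² Δ)^(s/2) u‖` in `L²`; it is equivalent to
`‖(1 - Δ)^(s/2) u‖`. -/
instance : NormedAddCommGroup (Sobolev k s) :=
  NormedAddCommGroup.induced (Sobolev k s) (L2 k) bessel bessel_injective

theorem norm_def (u : Sobolev k s) : ‖u‖ = ‖bessel u‖ := rfl

instance : NormedSpace ℂ (Sobolev k s) where
  norm_smul_le c u := by rw [norm_def, norm_def, map_smul, norm_smul]

/-- A Schwartz function, as an element of `H^s(ℝ^k)`. -/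
def ofSchwartz (s : ℝ) (φ : 𝓢(Euc k, ℂ)) : Sobolev k s :=
  ⟨(φ : 𝓢'(Euc k, ℂ)), φ.memSobolev⟩

end Sobolev

/-- `B : X → H^s(ℝ^k)` is the bounded operator `A : X → L²(ℝ^k)`, with its values regarded as
elements of `H^s(ℝ^k)`. -/
def IsSobolevLift {X : Type} [NormedAddCommGroup X] [NormedSpace ℂ X] {k : ℕ} (s : ℝ)
    (A : X →L[ℂ] L2 k) (B : X →L[ℂ] Sobolev k s) : Prop :=
  ∀ x, Sobolev.toDistribution (B x) = distr k (A x)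

/-- The bounded operator `A : X → L²(ℝ^k)` takes its values in `H^s(ℝ^k)`, and it is bounded as an
operator into `H^s(ℝ^k)`. -/
def MapsIntoSobolev {X : Type} [NormedAddCommGroup X] [NormedSpace ℂ X] {k : ℕ} (s : ℝ)
    (A : X →L[ℂ] L2 k) : Prop :=
  ∃ B : X →L[ℂ] Sobolev k s, IsSobolevLift s A B

open Classical in
/-- The operator `A`, regarded as an operator into `H^s(ℝ^k)` (and `0` if `A` is not bounded from
`X` into `H^s(ℝ^k)`). -/
def sobolevLift {X : Type} [NormedAddCommGroup X] [NormedSpace ℂ X] {k : ℕ} (s : ℝ)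
    (A : X →L[ℂ] L2 k) : X →L[ℂ] Sobolev k s :=
  if h : MapsIntoSobolev s A then h.choose else 0

/-! ### The free Laplacian and resolvents -/

/-- The space `H²(ℝ^k)`, as a subspace of `L²(ℝ^k)`. -/
def sobolevTwo (k : ℕ) : Submodule ℂ (L2 k) := (sobolevSubmodule k 2).comap (distr k)

/-- The distribution `-Δ f` for `f` in `H²(ℝ^k)`. -/
def negLaplacian (k : ℕ) : sobolevTwo k →ₗ[ℂ] 𝓢'(Euc k, ℂ) :=
  -((LineDeriv.laplacianCLM ℂ (Euc k) 𝓢'(Euc k, ℂ)).toLinearMap ∘ₗ distr k ∘ₗ (sobolevTwo k).subtype)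

theorem negLaplacian_apply {k : ℕ} (f : sobolevTwo k) :
    negLaplacian k f = -Δ (distr k f) :=
  congrArg Neg.neg (laplacianCLM_apply (distr k f))

theorem negLaplacian_mem_range {k : ℕ} (f : sobolevTwo k) :
    negLaplacian k f ∈ LinearMap.range (distr k) := by
  have hf : MemSobolev 2 2 (distr k f) := f.2
  have h := hf.laplacian.neg
  rw [show (2 : ℝ) - 2 = 0 by norm_num, memSobolev_zero_iff] at h
  obtain ⟨g, hg⟩ := h
  exact ⟨g, hg.symm.trans (negLaplacian_apply f).symm⟩

/-- The free Laplacian `f ↦ -Δ f` in `L²(ℝ^k)`, with domain `H²(ℝ^k)`; here `Δ` is the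
distributional Laplacian. -/
def freeLaplacian (k : ℕ) : L2 k →ₗ.[ℂ] L2 k where
  domain := sobolevTwo k
  toFun := liftL2 (negLaplacian k) negLaplacian_mem_range

/-- `R` is the bounded, everywhere defined inverse of `A - z`. -/
def IsResolvent {H : Type} [NormedAddCommGroup H] [NormedSpace ℂ H] (A : H →ₗ.[ℂ] H) (z : ℂ)
    (R : H →L[ℂ] H) : Prop :=
  (∀ f : H, ∃ h : R f ∈ A.domain, A ⟨R f, h⟩ - z • R f = f) ∧
    ∀ u : A.domain, R (A u - z • (u : H)) = u

open Classical in
/-- The resolvent `(A - z)⁻¹` (and `0` if `z` is not in the resolvent set of `A`). -/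
def resolventAt {H : Type} [NormedAddCommGroup H] [NormedSpace ℂ H] (A : H →ₗ.[ℂ] H) (z : ℂ) :
    H →L[ℂ] H :=
  if h : ∃ R : H →L[ℂ] H, IsResolvent A z R then h.choose else 0

/-- The free resolvent in `L²(ℝ³)`. -/
def freeResolvent (z : ℂ) : L2 3 →L[ℂ] L2 3 := resolventAt (freeLaplacian 3) z

/-! ### Traces -/

/-- The point `(F(x), x)` of `ℝ³`, where `x ∈ ℝ²`, on the graph of `F`. -/
def graphPoint (F : Euc 2 → ℝ) (x : Euc 2) : Euc 3 := !₂[F x, x 0, x 1]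

/-- `T` is a continuous extension to `H^s(ℝ³)` of the evaluation `φ ↦ φ(F(·), ·)` of smooth
compactly supported functions on the graph of `F`. -/
def IsTrace (F : Euc 2 → ℝ) (s : ℝ) (T : Sobolev 3 s →L[ℂ] L2 2) : Prop :=
  ∀ φ : 𝓢(Euc 3, ℂ), HasCompactSupport φ →
    T (Sobolev.ofSchwartz s φ) =ᵐ[volume] fun x => φ (graphPoint F x)

open Classical in
/-- The trace `τ_F : H^s(ℝ³) → L²(ℝ²)` on the graph of `F`. -/
def trace (F : Euc 2 → ℝ) (s : ℝ) : Sobolev 3 s →L[ℂ] L2 2 :=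
  if h : ∃ T, IsTrace F s T then h.choose else 0

/-- The Hilbert space `L²(Σ) ⊕ L²(Σ)`. -/
abbrev L2Pair (S : Set (Euc 2)) : Type := WithLp 2 (L2On S × L2On S)

/-- The trace `τ_Σ f = (τ_F f | Σ) ⊕ (τ_0 f | Σ)` from `H^s(ℝ³)` to `L²(Σ) ⊕ L²(Σ)`, where `Σ` is
the support of `F`. -/
def tracePair (F : Euc 2 → ℝ) (s : ℝ) : Sobolev 3 s →L[ℂ] L2Pair (tsupport F) :=
  (WithLp.prodContinuousLinearEquiv 2 ℂ (L2On (tsupport F)) (L2On (tsupport F))).symm.toContinuousLinearMap ∘L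
    ((LpToLpRestrictCLM (Euc 2) ℂ ℂ volume 2 (tsupport F) ∘L trace F s).prod
      (LpToLpRestrictCLM (Euc 2) ℂ ℂ volume 2 (tsupport F) ∘L trace 0 s))

/-- The operator `J = diag(1, -1)` on `L²(Σ) ⊕ L²(Σ)`. -/
def signJ (S : Set (Euc 2)) : L2Pair S →L[ℂ] L2Pair S :=
  (WithLp.prodContinuousLinearEquiv 2 ℂ (L2On S) (L2On S)).symm.toContinuousLinearMap ∘L
    ((ContinuousLinearMap.id ℂ (L2On S)).prodMap (-ContinuousLinearMap.id ℂ (L2On S))) ∘L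
      (WithLp.prodContinuousLinearEquiv 2 ℂ (L2On S) (L2On S)).toContinuousLinearMap

/-! ### Operators built from a trace and a family of resolvents -/

section Layer

variable {K : Type} [NormedAddCommGroup K] [InnerProductSpace ℂ K] [CompleteSpace K] {s : ℝ}

/-- The operator `τ R(z) : L²(ℝ³) → K`. -/
def traceResolvent (τ : Sobolev 3 s →L[ℂ] K) (R : ℂ → L2 3 →L[ℂ] L2 3) (z : ℂ) : L2 3 →L[ℂ] K :=
  τ ∘L sobolevLift s (R z)

/-- The operator `(τ R(z̄))* : K → L²(ℝ³)`. -/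
def layer (τ : Sobolev 3 s →L[ℂ] K) (R : ℂ → L2 3 →L[ℂ] L2 3) (z : ℂ) : K →L[ℂ] L2 3 :=
  ContinuousLinearMap.adjoint (traceResolvent τ R (conj z))

/-- The operator `τ (τ R(z̄))* : K → K`. -/
def traceLayer (τ : Sobolev 3 s →L[ℂ] K) (R : ℂ → L2 3 →L[ℂ] L2 3) (z : ℂ) : K →L[ℂ] K :=
  τ ∘L sobolevLift s (layer τ R z)

end Layer

/-- The operator `Γ_F(z) = 1 + α M_F(z)` in `L²(ℝ²)`, with `M_F(z) = τ_F G_F(z)` and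
`G_F(z) = (τ_F R_∅(z̄))*`. -/
def Gam (α : ℝ) (F : Euc 2 → ℝ) (z : ℂ) : L2 2 →L[ℂ] L2 2 :=
  1 + (α : ℂ) • traceLayer (trace F 1) freeResolvent z

/-- The resolvent `R_F(z) = R_∅(z) - α G_F(z) Γ_F(z)⁻¹ τ_F R_∅(z)` of the Laplacian with a
`δ`-interaction of strength `α` on the graph of `F`. -/
def deltaResolvent (α : ℝ) (F : Euc 2 → ℝ) (z : ℂ) : L2 3 →L[ℂ] L2 3 :=
  freeResolvent z - (α : ℂ) • (layer (trace F 1) freeResolvent z ∘L Ring.inverse (Gam α F z) ∘L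
    traceResolvent (trace F 1) freeResolvent z)

/-- The operator `1 + α J τ_Σ g_Σ(z)` in `L²(Σ) ⊕ L²(Σ)`, with `g_Σ(z) = (τ_Σ R_0(z̄))*`, for a
given trace `τ_Σ` and a given family `R_0`. -/
def lamDenominator {s : ℝ} {S : Set (Euc 2)} (α : ℝ) (τ : Sobolev 3 s →L[ℂ] L2Pair S)
    (R₀ : ℂ → L2 3 →L[ℂ] L2 3) (z : ℂ) : L2Pair S →L[ℂ] L2Pair S :=
  1 + (α : ℂ) • (signJ S ∘L traceLayer τ R₀ z)

/-- The operator `Λ_{F,Σ}(z) = -α (1 + α J τ_Σ g_Σ(z))⁻¹ J`. -/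
def lam {s : ℝ} {S : Set (Euc 2)} (α : ℝ) (τ : Sobolev 3 s →L[ℂ] L2Pair S)
    (R₀ : ℂ → L2 3 →L[ℂ] L2 3) (z : ℂ) : L2Pair S →L[ℂ] L2Pair S :=
  -((α : ℂ) • (Ring.inverse (lamDenominator α τ R₀ z) ∘L signJ S))

end DeltaPlane

end

/-! Write Λ for the Bessel operator of order 1, so that `besselInv 3 1` is Λ⁻¹. The unbounded
problem becomes one about bounded operators: R_∅(z) = Λ⁻¹ A Λ⁻¹, where A = `green` is the Fourier
multiplier (1 + |ξ|²)/((2π)²|ξ|² - z), with bounded inverse E = `energy z`. A trace on H¹ becomes a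
bounded operator T = τΛ⁻¹ on L² (`onL2`). Krein's formula then identifies the resolvent of the
δ-interaction as R_F(z) = Λ⁻¹ (E + α T_F* T_F)⁻¹ Λ⁻¹ (`deltaResolvent_eq`).

On these energy operators the interaction is additive. The two traces agree off Σ, so T_F* T_F -
T_0* T_0 = T_Σ* J T_Σ (`adjoint_comp_signJ_comp_tracePair`): only restrictions to Σ survive. For
bounded invertible H₀, H₁ with H₁ - H₀ = α S J T, the second resolvent identity shows that 1 +
αJTH₀⁻¹S has the explicit inverse 1 - αJTH₁⁻¹S, and it gives the difference formula
(`isUnit_perturbation`, `inverse_sub_inverse`). Conjugating back by Λ⁻¹ gives the claim; J need not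
be positive for this.

Three analytic facts support the algebra. The trace estimate for s > 1/2 comes from Fourier
inversion in the normal variable and Cauchy–Schwarz, uniformly in the height, so that it applies on
a graph (`lintegral_enorm_sq_graphPoint_le`). Γ is invertible because multiplication by c = √(-z),
Re c > 0, turns A into an operator with nonnegative real part (`isUnit_one_add_green`). Finally, A
commutes with Bessel potentials, so every order 1/2 < s < 3/2 yields the same operators as s = 1
(`IsConsistent.onL2_green_adjoint`); the upper bound is the condition 2 - s > 1/2 for the dual
trace. -/

noncomputable section

namespace DeltaPlane

/-! ### Fourier multipliers with bounded continuous symbol on L² -/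

section

open scoped BoundedContinuousFunction FourierTransform InnerProductSpace

variable {k : ℕ}

/-- Multiplication by a bounded continuous function on `L²(ℝ^k)`. -/
def mulOp (m : Euc k →ᵇ ℂ) : L2 k →L[ℂ] L2 k :=
  (ContinuousLinearMap.mul ℂ ℂ).holderL volume ⊤ 2 2 (m.memLp_top.toLp m)

theorem coeFn_mulOp (m : Euc k →ᵇ ℂ) (f : L2 k) :
    mulOp m f =ᵐ[volume] fun x => m x * f x := by
  have h := (ContinuousLinearMap.mul ℂ ℂ).coeFn_holder (r := 2)
    (m.memLp_top.toLp m : Lp ℂ ⊤ (volume : Measure (Euc k))) f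
  filter_upwards [h, (m.memLp_top (μ := (volume : Measure (Euc k)))).coeFn_toLp] with x h1 h2
  rw [mulOp, ContinuousLinearMap.holderL_apply_apply, h1, h2]
  rfl

theorem mulOp_mul (m n : Euc k →ᵇ ℂ) (f : L2 k) : mulOp (m * n) f = mulOp m (mulOp n f) := by
  apply Lp.ext
  filter_upwards [coeFn_mulOp (m * n) f, coeFn_mulOp m (mulOp n f), coeFn_mulOp n f]
    with x h1 h2 h3
  rw [h1, h2, h3, BoundedContinuousFunction.mul_apply, mul_assoc]

theorem mulOp_one (f : L2 k) : mulOp 1 f = f := by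
  apply Lp.ext
  filter_upwards [coeFn_mulOp 1 f] with x h1
  rw [h1]
  exact one_mul _

theorem mulOp_smul (c : ℂ) (m : Euc k →ᵇ ℂ) (f : L2 k) : mulOp (c • m) f = c • mulOp m f := by
  apply Lp.ext
  filter_upwards [coeFn_mulOp (c • m) f, coeFn_mulOp m f, Lp.coeFn_smul c (mulOp m f)]
    with x h1 h2 h3
  rw [h1, h3, Pi.smul_apply, h2, BoundedContinuousFunction.smul_apply, smul_eq_mul, smul_eq_mul,
    mul_assoc]

theorem mulOp_sub (m n : Euc k →ᵇ ℂ) (f : L2 k) : mulOp (m - n) f = mulOp m f - mulOp n f := by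
  apply Lp.ext
  filter_upwards [coeFn_mulOp (m - n) f, coeFn_mulOp m f, coeFn_mulOp n f,
    Lp.coeFn_sub (mulOp m f) (mulOp n f)] with x h1 h2 h3 h4
  rw [h1, h4, Pi.sub_apply, h2, h3, BoundedContinuousFunction.sub_apply, sub_mul]

theorem inner_mulOp_left (m : Euc k →ᵇ ℂ) (f g : L2 k) :
    ⟪mulOp m f, g⟫_ℂ = ⟪f, mulOp (star m) g⟫_ℂ := by
  rw [L2.inner_def, L2.inner_def]
  apply integral_congr_ae
  filter_upwards [coeFn_mulOp m f, coeFn_mulOp (star m) g] with x h1 h2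
  rw [h1, h2]
  simp only [RCLike.inner_apply, map_mul, BoundedContinuousFunction.star_apply, RCLike.star_def]
  ring

theorem re_inner_mulOp_nonneg {m : Euc k →ᵇ ℂ} (hm : ∀ x, 0 ≤ (m x).re) (f : L2 k) :
    0 ≤ (⟪mulOp m f, f⟫_ℂ).re := by
  rw [L2.inner_def]
  have hi : Integrable (fun x => ⟪mulOp m f x, f x⟫_ℂ) := L2.integrable_inner (𝕜 := ℂ) _ _
  have := integral_re hi
  simp only [RCLike.re_to_complex] at this
  rw [← this]
  apply integral_nonneg_of_ae
  filter_upwards [coeFn_mulOp m f] with x h1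
  rw [h1]
  have : (⟪m x * f x, f x⟫_ℂ).re = (m x).re * ‖f x‖ ^ 2 := by
    rw [← smul_eq_mul, inner_smul_left, inner_self_eq_norm_sq_to_K]
    simp [← Complex.ofReal_pow, Complex.mul_re]
  simp only [Pi.zero_apply]
  rw [this]
  exact mul_nonneg (hm x) (by positivity)

/-- The Fourier multiplier on `L²(ℝ^k)` with a bounded continuous symbol. -/
def fourierMul (m : Euc k →ᵇ ℂ) : L2 k →L[ℂ] L2 k :=
  (Lp.fourierTransformₗᵢ (Euc k) ℂ).symm.toContinuousLinearEquiv.toContinuousLinearMap ∘L mulOp m ∘L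
    (Lp.fourierTransformₗᵢ (Euc k) ℂ).toContinuousLinearEquiv.toContinuousLinearMap

theorem fourierMul_apply (m : Euc k →ᵇ ℂ) (f : L2 k) : fourierMul m f = 𝓕⁻ (mulOp m (𝓕 f)) := rfl

theorem fourier_fourierMul (m : Euc k →ᵇ ℂ) (f : L2 k) : 𝓕 (fourierMul m f) = mulOp m (𝓕 f) := by
  rw [fourierMul_apply, FourierTransform.fourier_fourierInv_eq]

theorem fourierMul_mul (m n : Euc k →ᵇ ℂ) : fourierMul (m * n) = fourierMul m ∘L fourierMul n := by
  ext1 f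
  rw [ContinuousLinearMap.comp_apply, fourierMul_apply m, fourier_fourierMul, ← mulOp_mul,
    fourierMul_apply]

theorem fourierMul_one : fourierMul (1 : Euc k →ᵇ ℂ) = 1 := by
  ext1 f
  rw [fourierMul_apply, mulOp_one, FourierTransform.fourierInv_fourier_eq]
  rfl

theorem fourierMul_smul (c : ℂ) (m : Euc k →ᵇ ℂ) : fourierMul (c • m) = c • fourierMul m := by
  ext1 f
  rw [fourierMul_apply, mulOp_smul, FourierTransform.fourierInv_smul]
  rfl

theorem fourierMul_sub (m n : Euc k →ᵇ ℂ) : fourierMul (m - n) = fourierMul m - fourierMul n := by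
  ext1 f
  rw [fourierMul_apply, mulOp_sub]
  exact map_sub (Lp.fourierTransformₗᵢ (Euc k) ℂ).symm _ _

theorem fourierMul_comm (m n : Euc k →ᵇ ℂ) :
    fourierMul m ∘L fourierMul n = fourierMul n ∘L fourierMul m := by
  rw [← fourierMul_mul, mul_comm, fourierMul_mul]

theorem adjoint_fourierMul (m : Euc k →ᵇ ℂ) :
    ContinuousLinearMap.adjoint (fourierMul m) = fourierMul (star m) := by
  symm
  rw [ContinuousLinearMap.eq_adjoint_iff]
  intro f g
  rw [← Lp.inner_fourier_eq, fourier_fourierMul, inner_mulOp_left, star_star,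
    ← fourier_fourierMul, Lp.inner_fourier_eq]

theorem re_inner_fourierMul_nonneg {m : Euc k →ᵇ ℂ} (hm : ∀ x, 0 ≤ (m x).re) (f : L2 k) :
    0 ≤ (⟪fourierMul m f, f⟫_ℂ).re := by
  rw [← Lp.inner_fourier_eq, fourier_fourierMul]
  exact re_inner_mulOp_nonneg hm _

theorem distr_apply (f : L2 k) : distr k f = (f : 𝓢'(Euc k, ℂ)) := rfl

/-- A Fourier multiplier on distributions, applied to a Fourier multiplier on `L²`, when the product
of the symbols is bounded. -/
theorem fourierMultiplierCLM_distr_fourierMul {a : Euc k → ℂ} (ha : a.HasTemperateGrowth)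
    {m n : Euc k →ᵇ ℂ} (h : ∀ x, n x = a x * m x) (f : L2 k) :
    fourierMultiplierCLM ℂ a (distr k (fourierMul m f)) = distr k (fourierMul n f) := by
  rw [fourierMultiplierCLM_apply, distr_apply, distr_apply, Lp.fourier_toTemperedDistribution_eq,
    fourier_fourierMul, fourierMul_apply n, ← Lp.fourierInv_toTemperedDistribution_eq]
  congr 1
  -- After the Fourier transform both sides are functions acting on φ by integration, so a pointwise
  -- comparison of integrands suffices.
  ext φ
  rw [smulLeftCLM_apply_apply, Lp.toTemperedDistribution_apply, Lp.toTemperedDistribution_apply]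
  apply integral_congr_ae
  filter_upwards [coeFn_mulOp m (𝓕 f), coeFn_mulOp n (𝓕 f)] with x h1 h2
  rw [h1, h2, h, SchwartzMap.smulLeftCLM_apply_apply ha]
  simp only [smul_eq_mul]
  ring

end

/-! ### Bessel potentials and lifts to Sobolev spaces -/

section

open scoped BoundedContinuousFunction FourierTransform InnerProductSpace

variable {k : ℕ} {s t : ℝ}

namespace Sobolev

/-- The element of `H^s(ℝ^k)` with a given image in `L²` under the Bessel potential operator. -/
def ofBessel (s : ℝ) (g : L2 k) : Sobolev k s :=
  ⟨besselPotential (Euc k) ℂ (-s) (distr k g), g, by simp [distr_apply]⟩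

theorem toDistribution_ofBessel (g : L2 k) :
    toDistribution (ofBessel s g) = besselPotential (Euc k) ℂ (-s) (distr k g) := rfl

theorem bessel_ofBessel (g : L2 k) : bessel (ofBessel s g) = g := by
  apply distr_injective
  rw [distr_bessel, toDistribution_ofBessel]
  simp

/-- The Bessel potential operator, as an isometry from `H^s(ℝ^k)` onto `L²(ℝ^k)`. -/
def besselEquiv (k : ℕ) (s : ℝ) : Sobolev k s ≃ₗᵢ[ℂ] L2 k :=
  LinearIsometryEquiv.ofSurjective ⟨bessel, fun u => (norm_def u).symm⟩
    fun g => ⟨ofBessel s g, bessel_ofBessel g⟩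

theorem besselEquiv_apply (u : Sobolev k s) : besselEquiv k s u = bessel u := rfl

theorem besselEquiv_symm_apply (g : L2 k) : (besselEquiv k s).symm g = ofBessel s g := by
  rw [LinearIsometryEquiv.symm_apply_eq, besselEquiv_apply, bessel_ofBessel]

theorem toDistribution_besselEquiv_symm (g : L2 k) :
    toDistribution ((besselEquiv k s).symm g) = besselPotential (Euc k) ℂ (-s) (distr k g) := by
  rw [besselEquiv_symm_apply, toDistribution_ofBessel]

end Sobolev

/-- The symbol `(1 + |ξ|²)^(-s/2)` for `s ≥ 0` (and `1` for `s < 0`). -/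
def besselSymbol (k : ℕ) (s : ℝ) : Euc k →ᵇ ℂ :=
  BoundedContinuousFunction.ofNormedAddCommGroup
    (fun ξ => (((1 + ‖ξ‖ ^ 2) ^ (-(max s 0) / 2) : ℝ) : ℂ))
    (Complex.continuous_ofReal.comp (Continuous.rpow_const (by fun_prop)
      fun ξ => Or.inl (by positivity))) 1 (by
      intro ξ
      rw [Complex.norm_real, Real.norm_of_nonneg (by positivity)]
      apply Real.rpow_le_one_of_one_le_of_nonpos
      · nlinarith [sq_nonneg ‖ξ‖]
      · have := le_max_right s 0
        linarith)

theorem besselSymbol_apply (hs : 0 ≤ s) (ξ : Euc k) :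
    besselSymbol k s ξ = (((1 + ‖ξ‖ ^ 2) ^ (-s / 2) : ℝ) : ℂ) := by
  rw [besselSymbol, BoundedContinuousFunction.coe_ofNormedAddCommGroup, max_eq_left hs]

theorem besselSymbol_mul (hs : 0 ≤ s) (ht : 0 ≤ t) :
    besselSymbol k s * besselSymbol k t = besselSymbol k (s + t) := by
  ext ξ
  rw [BoundedContinuousFunction.mul_apply, besselSymbol_apply hs, besselSymbol_apply ht,
    besselSymbol_apply (add_nonneg hs ht), ← Complex.ofReal_mul, ← Real.rpow_add (by positivity)]
  congr 2
  ring

theorem star_besselSymbol : star (besselSymbol k s) = besselSymbol k s := by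
  ext ξ
  rw [BoundedContinuousFunction.star_apply, besselSymbol,
    BoundedContinuousFunction.coe_ofNormedAddCommGroup, RCLike.star_def, Complex.conj_ofReal]

/-- The operator `(1 - (2π)⁻² Δ)^(-s/2)` in `L²(ℝ^k)`, for `s ≥ 0`. -/
def besselInv (k : ℕ) (s : ℝ) : L2 k →L[ℂ] L2 k := fourierMul (besselSymbol k s)

theorem besselInv_add (hs : 0 ≤ s) (ht : 0 ≤ t) :
    besselInv k (s + t) = besselInv k s ∘L besselInv k t := by
  rw [besselInv, ← besselSymbol_mul hs ht, fourierMul_mul]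
  rfl

theorem adjoint_besselInv : ContinuousLinearMap.adjoint (besselInv k s) = besselInv k s := by
  rw [besselInv, adjoint_fourierMul, star_besselSymbol]

theorem besselPotential_distr_besselInv (hs : 0 ≤ s) (f : L2 k) :
    besselPotential (Euc k) ℂ s (distr k (besselInv k s f)) = distr k f := by
  rw [besselPotential, besselInv,
    fourierMultiplierCLM_distr_fourierMul (n := 1) (by fun_prop) ?_ f, fourierMul_one]
  · rfl
  · intro ξ
    rw [besselSymbol_apply hs, ← Complex.ofReal_mul, ← Real.rpow_add (by positivity)]
    simp [neg_div]

theorem distr_besselInv (hs : 0 ≤ s) (f : L2 k) :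
    distr k (besselInv k s f) = besselPotential (Euc k) ℂ (-s) (distr k f) := by
  rw [eq_comm, besselPotential_neg_apply_eq_iff, besselPotential_distr_besselInv hs]

/-- In the L² coordinates given by `bessel`, the inclusion of H^t in H^s is the smoothing operator
of order t - s. -/
theorem Sobolev.besselInv_bessel (hst : s ≤ t) {u : Sobolev k t} {v : Sobolev k s}
    (h : toDistribution u = toDistribution v) : besselInv k (t - s) (bessel u) = bessel v := by
  apply distr_injective
  rw [distr_besselInv (sub_nonneg.2 hst), distr_bessel, distr_bessel, h]
  simp

section Lift

variable {X : Type} [NormedAddCommGroup X] [NormedSpace ℂ X]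

theorem isSobolevLift_besselInv_comp (hs : 0 ≤ s) (C : X →L[ℂ] L2 k) :
    IsSobolevLift s (besselInv k s ∘L C)
      ((Sobolev.besselEquiv k s).symm.toContinuousLinearEquiv.toContinuousLinearMap ∘L C) := by
  intro x
  exact (Sobolev.toDistribution_besselEquiv_symm _).trans (distr_besselInv hs _).symm

theorem IsSobolevLift.unique {A : X →L[ℂ] L2 k} {B B' : X →L[ℂ] Sobolev k s}
    (h : IsSobolevLift s A B) (h' : IsSobolevLift s A B') : B = B' := by
  ext1 x
  exact Sobolev.toDistribution_injective ((h x).trans (h' x).symm)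

theorem mapsIntoSobolev_of_eq (hs : 0 ≤ s) {A : X →L[ℂ] L2 k} {C : X →L[ℂ] L2 k}
    (h : A = besselInv k s ∘L C) : MapsIntoSobolev s A :=
  ⟨_, h ▸ isSobolevLift_besselInv_comp hs C⟩

/-- A factor `besselInv k s` on the left certifies values in H^s, and the remaining factor is the
lift in L² coordinates. Lifts are unique, so the choice made in `sobolevLift` does not matter; every
later lift is computed in this way. -/
theorem sobolevLift_of_eq (hs : 0 ≤ s) {A : X →L[ℂ] L2 k} {C : X →L[ℂ] L2 k}
    (h : A = besselInv k s ∘L C) :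
    sobolevLift s A =
      (Sobolev.besselEquiv k s).symm.toContinuousLinearEquiv.toContinuousLinearMap ∘L C := by
  have hA := mapsIntoSobolev_of_eq hs h
  rw [sobolevLift, dif_pos hA]
  exact hA.choose_spec.unique (h ▸ isSobolevLift_besselInv_comp hs C)

end Lift

end

/-! ### Density of compactly supported smooth functions -/

section

open scoped ContDiff Topology

section Cutoff

variable {E V : Type*} [NormedAddCommGroup E] [InnerProductSpace ℝ E]
  [NormedAddCommGroup V] [NormedSpace ℝ V]

/-- The gain of a factor c has two sources: the hypothesis on 1 - χ for order zero, and the chain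
rule factor cⁱ ≤ c for order i ≥ 1. The growth 1 + ‖x‖ is harmless against a Schwartz function. -/
theorem exists_norm_iteratedFDeriv_one_sub_le {χ : E → ℝ} (hχ : ContDiff ℝ ∞ χ)
    (hc : HasCompactSupport χ) (h0 : ∀ x, |1 - χ x| ≤ ‖x‖) (n : ℕ) :
    ∃ M : ℝ, 0 ≤ M ∧ ∀ c : ℝ, 0 < c → c ≤ 1 → ∀ i ≤ n, ∀ x,
      ‖iteratedFDeriv ℝ i (fun y => 1 - χ (c • y)) x‖ ≤ c * M * (1 + ‖x‖) := by
  have hb : ∀ i : ℕ, ∃ B : ℝ, ∀ x, ‖iteratedFDeriv ℝ i χ x‖ ≤ B := by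
    intro i
    exact ((hc.iteratedFDeriv (𝕜 := ℝ) i).exists_bound_of_continuous
      (hχ.continuous_iteratedFDeriv (mod_cast le_top)))
  choose B hB using hb
  have hB0 : ∀ i, 0 ≤ B i := fun i => (norm_nonneg _).trans (hB i 0)
  refine ⟨1 + ∑ i ∈ Finset.range (n + 1), B i,
    add_nonneg zero_le_one (Finset.sum_nonneg fun i _ => hB0 i), ?_⟩
  intro c hc0 hc1 i hi x
  have hle : B i ≤ ∑ i ∈ Finset.range (n + 1), B i :=
    Finset.single_le_sum (fun j _ => hB0 j) (Finset.mem_range.2 (by omega))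
  have hx := norm_nonneg x
  rcases Nat.eq_zero_or_pos i with rfl | hi0
  · rw [norm_iteratedFDeriv_zero, Real.norm_eq_abs]
    refine (h0 (c • x)).trans ?_
    rw [norm_smul, Real.norm_of_nonneg hc0.le, mul_assoc]
    gcongr
    nlinarith [hB0 0]
  · have hs : ContDiff ℝ i χ := hχ.of_le (mod_cast le_top)
    have hs' : ContDiff ℝ i (fun y => χ (c • y)) := hs.comp (contDiff_const_smul c)
    have heq : iteratedFDeriv ℝ i (fun y => 1 - χ (c • y)) x
        = -(c ^ i • iteratedFDeriv ℝ i χ (c • x)) := by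
      have := iteratedFDeriv_sub_apply (𝕜 := ℝ) (i := i) (x := x) (f := fun _ : E => (1 : ℝ))
        (g := fun y => χ (c • y)) contDiff_const.contDiffAt hs'.contDiffAt
      rw [iteratedFDeriv_const_of_ne hi0.ne', iteratedFDeriv_comp_const_smul c hs] at this
      simpa [Pi.sub_def] using this
    rw [heq, norm_neg, norm_smul, norm_pow, Real.norm_of_nonneg hc0.le]
    have h1 : c ^ i ≤ c := pow_le_of_le_one hc0.le hc1 hi0.ne'
    calc c ^ i * ‖iteratedFDeriv ℝ i χ (c • x)‖ ≤ c * B i := by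
          gcongr
          exact hB i _
      _ ≤ c * (1 + ∑ i ∈ Finset.range (n + 1), B i) * (1 + ‖x‖) := by
          rw [mul_assoc]
          gcongr
          nlinarith [hB0 i]

/-- By the Leibniz rule, each derivative of the cutoff error costs c(1 + ‖x‖), which raises the
decay index of the seminorm of φ by at most one. -/
theorem seminorm_smulLeftCLM_cutoff_sub_le {χ : E → ℝ} (hχ : ContDiff ℝ ∞ χ)
    (hc : HasCompactSupport χ) (h0 : ∀ x, |1 - χ x| ≤ ‖x‖) (φ : 𝓢(E, V)) (k n : ℕ) :
    ∃ C : ℝ, ∀ c : ℝ, 0 < c → c ≤ 1 →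
      SchwartzMap.seminorm ℝ k n (SchwartzMap.smulLeftCLM V (fun x => χ (c • x)) φ - φ)
        ≤ c * C := by
  obtain ⟨M, hM0, hM⟩ := exists_norm_iteratedFDeriv_one_sub_le hχ hc h0 n
  let C : ℝ := ∑ i ∈ Finset.range (n + 1), (n.choose i : ℝ) * M *
    (SchwartzMap.seminorm ℝ k (n - i) φ + SchwartzMap.seminorm ℝ (k + 1) (n - i) φ)
  have hC : 0 ≤ C := Finset.sum_nonneg fun i _ => by positivity
  refine ⟨C, fun c hc0 hc1 => ?_⟩
  have hsm : ContDiff ℝ ∞ (fun x => χ (c • x)) := hχ.comp (contDiff_const_smul c)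
  have htg : (fun x => χ (c • x)).HasTemperateGrowth :=
    (hc.comp_smul hc0.ne').hasTemperateGrowth hsm
  refine SchwartzMap.seminorm_le_bound ℝ k n _ (by positivity) fun x => ?_
  have heq : ⇑(SchwartzMap.smulLeftCLM V (fun x => χ (c • x)) φ - φ)
      = -(fun y => (1 - χ (c • y)) • φ y) := by
    ext y
    rw [sub_apply, SchwartzMap.smulLeftCLM_apply_apply htg, Pi.neg_apply, sub_smul,
      one_smul, neg_sub]
  rw [heq, iteratedFDeriv_neg, Pi.neg_apply, norm_neg]
  have hψ : ContDiff ℝ ∞ (fun y => 1 - χ (c • y)) := contDiff_const.sub hsm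
  have hle := norm_iteratedFDeriv_smul_le hψ (φ.smooth ⊤) x (n := n) (mod_cast le_top)
  calc ‖x‖ ^ k * ‖iteratedFDeriv ℝ n (fun y => (1 - χ (c • y)) • φ y) x‖
      ≤ ‖x‖ ^ k * ∑ i ∈ Finset.range (n + 1), (n.choose i : ℝ) *
          ‖iteratedFDeriv ℝ i (fun y => 1 - χ (c • y)) x‖ * ‖iteratedFDeriv ℝ (n - i) φ x‖ := by
        gcongr
    _ ≤ c * C := by
        rw [Finset.mul_sum, Finset.mul_sum]
        refine Finset.sum_le_sum fun i hi => ?_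
        have h1 := hM c hc0 hc1 i (by have := Finset.mem_range.1 hi; omega) x
        have h2 := φ.le_seminorm ℝ k (n - i) x
        have h3 := φ.le_seminorm ℝ (k + 1) (n - i) x
        calc ‖x‖ ^ k * ((n.choose i : ℝ) *
              ‖iteratedFDeriv ℝ i (fun y => 1 - χ (c • y)) x‖ * ‖iteratedFDeriv ℝ (n - i) φ x‖)
            ≤ ‖x‖ ^ k * ((n.choose i : ℝ) * (c * M * (1 + ‖x‖)) *
                ‖iteratedFDeriv ℝ (n - i) φ x‖) := by gcongr
          _ = c * ((n.choose i : ℝ) * M * (‖x‖ ^ k * ‖iteratedFDeriv ℝ (n - i) φ x‖ +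
                ‖x‖ ^ (k + 1) * ‖iteratedFDeriv ℝ (n - i) φ x‖)) := by ring
          _ ≤ _ := by gcongr

variable [FiniteDimensional ℝ E] in
/-- Compactly supported functions are dense in the Schwartz space. -/
theorem dense_hasCompactSupport : Dense {φ : 𝓢(E, V) | HasCompactSupport φ} := by
  let f : ContDiffBump (0 : E) := ⟨1, 2, one_pos, one_lt_two⟩
  -- The error 1 - f vanishes on the unit ball and is at most 1 ≤ ‖x‖ outside it.
  have h0 : ∀ x, |1 - f x| ≤ ‖x‖ := by
    intro x
    rcases le_total ‖x‖ 1 with hx | hx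
    · rw [f.one_of_mem_closedBall (by simpa [f] using hx)]
      simp
    · rw [abs_of_nonneg (sub_nonneg.2 f.le_one)]
      linarith [f.nonneg (x := x)]
  intro φ
  have hlim : Filter.Tendsto (fun c : ℝ => SchwartzMap.smulLeftCLM V (fun x => f (c • x)) φ)
      (𝓝[>] 0) (𝓝 φ) := by
    rw [(schwartz_withSeminorms ℝ E V).tendsto_nhds]
    rintro ⟨k, n⟩ ε hε
    obtain ⟨C, hC⟩ := seminorm_smulLeftCLM_cutoff_sub_le f.contDiff f.hasCompactSupport h0 φ k n
    have h1 : Filter.Tendsto (fun c : ℝ => c * C) (𝓝[>] 0) (𝓝 0) := by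
      have : Filter.Tendsto (fun c : ℝ => c * C) (𝓝 0) (𝓝 (0 * C)) :=
        (continuous_id.mul continuous_const).tendsto 0
      rw [zero_mul] at this
      exact this.mono_left nhdsWithin_le_nhds
    filter_upwards [h1.eventually_lt_const hε, Ioc_mem_nhdsGT one_pos] with c hc hc'
    exact (hC c hc'.1 hc'.2).trans_lt hc
  refine mem_closure_of_tendsto hlim ?_
  filter_upwards [self_mem_nhdsWithin] with c hc
  have hc' : c ≠ 0 := (Set.mem_Ioi.1 hc).ne'
  have htg : (fun x => f (c • x)).HasTemperateGrowth :=
    (f.hasCompactSupport.comp_smul hc').hasTemperateGrowth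
      (f.contDiff.comp (contDiff_const_smul c))
  change HasCompactSupport _
  rw [SchwartzMap.smulLeftCLM_apply htg]
  exact (f.hasCompactSupport.comp_smul hc').smul_right

end Cutoff

variable {k : ℕ} {s : ℝ}

namespace Sobolev

/-- The Bessel potential operator on Schwartz functions. -/
def besselSchwartz (k : ℕ) (s : ℝ) : 𝓢(Euc k, ℂ) →L[ℂ] 𝓢(Euc k, ℂ) :=
  SchwartzMap.fourierMultiplierCLM ℂ (fun x => (((1 + ‖x‖ ^ 2) ^ (s / 2) : ℝ) : ℂ))

theorem bessel_ofSchwartz (φ : 𝓢(Euc k, ℂ)) :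
    bessel (ofSchwartz s φ) = SchwartzMap.toLpCLM ℂ ℂ 2 volume (besselSchwartz k s φ) := by
  apply distr_injective
  rw [distr_bessel, distr_apply, SchwartzMap.toLpCLM_apply, Lp.toTemperedDistribution_toLp_eq,
    besselSchwartz, ← fourierMultiplierCLM_toTemperedDistributionCLM_eq (by fun_prop)]
  rfl

theorem besselSchwartz_surjective : Function.Surjective (besselSchwartz k s) := by
  intro φ
  refine ⟨besselSchwartz k (-s) φ, ?_⟩
  rw [besselSchwartz, besselSchwartz, SchwartzMap.fourierMultiplierCLM_fourierMultiplierCLM_apply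
    (by fun_prop) (by fun_prop)]
  have : ((fun x : Euc k => (((1 + ‖x‖ ^ 2) ^ (s / 2) : ℝ) : ℂ)) *
      fun x => (((1 + ‖x‖ ^ 2) ^ (-s / 2) : ℝ) : ℂ)) = fun _ => 1 := by
    ext x
    rw [Pi.mul_apply, ← Complex.ofReal_mul, ← Real.rpow_add (by positivity)]
    simp [neg_div]
  rw [this]
  simp

/-- The inclusion of the Schwartz space in `H^s(ℝ^k)`. -/
def ofSchwartzCLM (k : ℕ) (s : ℝ) : 𝓢(Euc k, ℂ) →L[ℂ] Sobolev k s :=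
  (besselEquiv k s).symm.toContinuousLinearEquiv.toContinuousLinearMap ∘L
    SchwartzMap.toLpCLM ℂ ℂ 2 volume ∘L besselSchwartz k s

theorem ofSchwartzCLM_apply (φ : 𝓢(Euc k, ℂ)) : ofSchwartzCLM k s φ = ofSchwartz s φ := by
  have : ofSchwartzCLM k s φ = (besselEquiv k s).symm (bessel (ofSchwartz s φ)) := by
    rw [bessel_ofSchwartz]
    rfl
  rw [this, LinearIsometryEquiv.symm_apply_eq, besselEquiv_apply]

theorem denseRange_ofSchwartzCLM : DenseRange (ofSchwartzCLM k s) := by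
  have h1 : DenseRange (SchwartzMap.toLpCLM ℂ (E := Euc k) ℂ 2 volume) :=
    SchwartzMap.denseRange_toLpCLM ENNReal.ofNat_ne_top
  have h2 : DenseRange (besselEquiv k s).symm := (besselEquiv k s).symm.surjective.denseRange
  exact h2.comp (h1.comp besselSchwartz_surjective.denseRange
    (SchwartzMap.toLpCLM ℂ ℂ 2 volume).continuous) (besselEquiv k s).symm.continuous

/-- A continuous map on `H^s(ℝ^k)` is determined by its values at the compactly supported smooth
functions. -/
theorem ext_of_hasCompactSupport {Y : Type*} [TopologicalSpace Y] [T2Space Y]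
    {T T' : Sobolev k s → Y} (hT : Continuous T) (hT' : Continuous T')
    (h : ∀ φ : 𝓢(Euc k, ℂ), HasCompactSupport φ → T (ofSchwartz s φ) = T' (ofSchwartz s φ)) :
    T = T' := by
  have hd : Dense (ofSchwartzCLM k s '' {φ : 𝓢(Euc k, ℂ) | HasCompactSupport φ}) :=
    denseRange_ofSchwartzCLM.dense_image (ofSchwartzCLM k s).continuous dense_hasCompactSupport
  refine Continuous.ext_on hd hT hT' ?_
  rintro _ ⟨φ, hφ, rfl⟩
  rw [ofSchwartzCLM_apply]
  exact h φ hφ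

end Sobolev

end

/-! ### The trace estimate on a graph -/

section

open scoped FourierTransform InnerProductSpace ENNReal

/-- The isometry `(t, x) ↦ (t, x₁, x₂)` from `ℝ × ℝ²` onto `ℝ³`. -/
def consIsometry : WithLp 2 (ℝ × Euc 2) ≃ₗᵢ[ℝ] Euc 3 where
  toFun p := !₂[p.fst, p.snd 0, p.snd 1]
  invFun y := WithLp.toLp 2 (y 0, !₂[y 1, y 2])
  map_add' p q := by ext i; fin_cases i <;> rfl
  map_smul' c p := by ext i; fin_cases i <;> rfl
  left_inv p := by
    apply WithLp.ofLp_injective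
    refine Prod.ext rfl ?_
    ext i
    fin_cases i <;> rfl
  right_inv y := by ext i; fin_cases i <;> rfl
  norm_map' p := by
    have h : ‖(!₂[p.fst, p.snd 0, p.snd 1] : Euc 3)‖ ^ 2 = ‖p‖ ^ 2 := by
      rw [EuclideanSpace.norm_sq_eq, WithLp.prod_norm_sq_eq_of_L2, EuclideanSpace.norm_sq_eq,
        Fin.sum_univ_three, Fin.sum_univ_two]
      simp [add_assoc]
    exact (sq_eq_sq₀ (norm_nonneg _) (norm_nonneg _)).1 h

/-- The point `(t, x)` of `ℝ³`, for `t ∈ ℝ` and `x ∈ ℝ²`. -/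
def consPoint (p : ℝ × Euc 2) : Euc 3 := consIsometry (WithLp.toLp 2 p)

theorem continuous_consPoint : Continuous consPoint :=
  consIsometry.continuous.comp (WithLp.prod_continuous_toLp 2 ℝ (Euc 2))

theorem measurePreserving_consPoint : MeasurePreserving consPoint volume volume :=
  consIsometry.measurePreserving.comp (WithLp.volume_preserving_toLp ℝ (Euc 2))

theorem measurableEmbedding_consPoint : MeasurableEmbedding consPoint :=
  consIsometry.toHomeomorph.measurableEmbedding.comp
    (MeasurableEquiv.toLp 2 (ℝ × Euc 2)).measurableEmbedding

theorem norm_sq_consPoint (p : ℝ × Euc 2) : ‖consPoint p‖ ^ 2 = p.1 ^ 2 + ‖p.2‖ ^ 2 := by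
  rw [consPoint, LinearIsometryEquiv.norm_map, WithLp.prod_norm_sq_eq_of_L2]
  simp

theorem inner_consPoint (p q : ℝ × Euc 2) :
    ⟪consPoint p, consPoint q⟫_ℝ = p.1 * q.1 + ⟪p.2, q.2⟫_ℝ := by
  rw [consPoint, consPoint, LinearIsometryEquiv.inner_map_map, WithLp.prod_inner_apply]
  simp [mul_comm]

theorem consPoint_eq_add (t : ℝ) (x : Euc 2) :
    consPoint (t, x) = consPoint (t, 0) + consPoint (0, x) := by
  rw [consPoint, consPoint, consPoint, ← map_add, ← WithLp.toLp_add]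
  simp

/-- The inclusion `x ↦ (0, x)` of `ℝ²` in `ℝ³`. -/
def planeInclusion : Euc 2 →L[ℝ] Euc 3 :=
  LinearMap.toContinuousLinearMap
    { toFun := fun x => consPoint (0, x)
      map_add' := fun x y => by
        have h : ((0 : ℝ), x + y) = (0, x) + (0, y) := by rw [Prod.mk_add_mk, add_zero]
        rw [consPoint, h, WithLp.toLp_add, map_add]
        rfl
      map_smul' := fun c x => by
        have h : ((0 : ℝ), c • x) = c • (0, x) := by rw [Prod.smul_mk, smul_zero]
        rw [consPoint, h, WithLp.toLp_smul, map_smul]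
        rfl }

theorem planeInclusion_apply (x : Euc 2) : planeInclusion x = consPoint (0, x) := rfl

theorem hasTemperateGrowth_consPoint (t : ℝ) :
    (fun x => consPoint (t, x)).HasTemperateGrowth := by
  have : (fun x => consPoint (t, x)) = fun x => consPoint (t, 0) + planeInclusion x := by
    ext1 x
    rw [consPoint_eq_add, planeInclusion_apply]
  rw [this]
  exact (Function.HasTemperateGrowth.const _).fun_add planeInclusion.hasTemperateGrowth

theorem norm_le_norm_consPoint (t : ℝ) (x : Euc 2) : ‖x‖ ≤ ‖consPoint (t, x)‖ := by
  refine le_of_sq_le_sq ?_ (norm_nonneg _)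
  rw [norm_sq_consPoint]
  nlinarith [sq_nonneg t]

/-- The restriction `x ↦ ψ(t, x)` of a Schwartz function on `ℝ³`. -/
def slice (ψ : 𝓢(Euc 3, ℂ)) (t : ℝ) : 𝓢(Euc 2, ℂ) :=
  SchwartzMap.compCLM ℂ (hasTemperateGrowth_consPoint t)
    ⟨1, 1, fun x => by
      have := norm_le_norm_consPoint t x
      rw [pow_one, one_mul]
      linarith⟩ ψ

theorem slice_apply (ψ : 𝓢(Euc 3, ℂ)) (t : ℝ) (x : Euc 2) : slice ψ t x = ψ (consPoint (t, x)) :=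
  rfl

theorem norm_exp_ofReal_mul_I_smul (a : ℝ) (c : ℂ) : ‖Complex.exp (a * Complex.I) • c‖ = ‖c‖ := by
  rw [norm_smul, Complex.norm_exp_ofReal_mul_I, one_mul]

/-- The partial Fourier representation of a Schwartz function. -/
theorem apply_consPoint_eq_integral (φ : 𝓢(Euc 3, ℂ)) (a : ℝ) (x : Euc 2) :
    φ (consPoint (a, x)) = ∫ t : ℝ, Complex.exp ((2 * Real.pi * (t * a) : ℝ) * Complex.I) •
      (𝓕⁻ (slice (𝓕 φ) t) : 𝓢(Euc 2, ℂ)) x := by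
  have h1 : φ (consPoint (a, x)) = (𝓕⁻ (𝓕 φ) : 𝓢(Euc 3, ℂ)) (consPoint (a, x)) := by
    rw [FourierTransform.fourierInv_fourier_eq]
  have hcont : Continuous fun y : Euc 3 =>
      Complex.exp ((2 * Real.pi * ⟪y, consPoint (a, x)⟫_ℝ : ℝ) * Complex.I) := by fun_prop
  have hint : Integrable fun y : Euc 3 =>
      Complex.exp ((2 * Real.pi * ⟪y, consPoint (a, x)⟫_ℝ : ℝ) * Complex.I) • (𝓕 φ) y := by
    refine ((𝓕 φ : 𝓢(Euc 3, ℂ)).integrable).mono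
      (hcont.smul (𝓕 φ : 𝓢(Euc 3, ℂ)).continuous).aestronglyMeasurable ?_
    exact Filter.Eventually.of_forall fun y => (norm_exp_ofReal_mul_I_smul _ _).le
  rw [h1, SchwartzMap.fourierInv_coe, Real.fourierInv_eq',
    ← measurePreserving_consPoint.integral_comp measurableEmbedding_consPoint]
  have hint2 := (measurePreserving_consPoint.integrable_comp_emb measurableEmbedding_consPoint).2
    hint
  -- Fubini: up to the phase in t, the inner integral over the tangential frequency is the
  -- two-dimensional inverse transform of a slice.
  refine (integral_prod _ hint2).trans ?_
  congr 1
  ext1 t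
  simp only [Function.comp_apply]
  rw [SchwartzMap.fourierInv_coe, Real.fourierInv_eq', ← integral_smul]
  congr 1
  ext1 η
  rw [slice_apply, smul_smul, ← Complex.exp_add, inner_consPoint]
  congr 2
  push_cast
  ring

theorem lintegral_enorm_sq_eq {X : Type*} [MeasurableSpace X] {μ : Measure X} (f : X → ℂ) :
    ∫⁻ x, ‖f x‖ₑ ^ 2 ∂μ = eLpNorm f 2 μ ^ 2 := by
  have h := eLpNorm_nnreal_pow_eq_lintegral (f := f) (μ := μ) (p := 2) two_ne_zero
  simpa using h.symm

theorem lintegral_enorm_sq_fourierInv {n : ℕ} (ψ : 𝓢(Euc n, ℂ)) :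
    ∫⁻ x, ‖(𝓕⁻ ψ : 𝓢(Euc n, ℂ)) x‖ₑ ^ 2 = ∫⁻ x, ‖ψ x‖ₑ ^ 2 := by
  have h := SchwartzMap.norm_fourier_toL2_eq (𝓕⁻ ψ)
  rw [FourierTransform.fourier_fourierInv_eq, SchwartzMap.norm_toLp, SchwartzMap.norm_toLp] at h
  have h1 : eLpNorm ψ 2 volume ≠ ⊤ := (ψ.eLpNorm_lt_top 2 volume).ne
  have h2 : eLpNorm (𝓕⁻ ψ : 𝓢(Euc n, ℂ)) 2 volume ≠ ⊤ :=
    ((𝓕⁻ ψ : 𝓢(Euc n, ℂ)).eLpNorm_lt_top 2 volume).ne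
  rw [lintegral_enorm_sq_eq, lintegral_enorm_sq_eq, (ENNReal.toReal_eq_toReal_iff' h1 h2).1 h]

/-- Joint measurability is needed for Tonelli; it holds because the inverse transform is a parameter
integral of a jointly continuous function. -/
theorem measurable_fourierInv_slice (ψ : 𝓢(Euc 3, ℂ)) :
    Measurable fun p : ℝ × Euc 2 => (𝓕⁻ (slice ψ p.1) : 𝓢(Euc 2, ℂ)) p.2 := by
  have h : Continuous (Function.uncurry fun (p : ℝ × Euc 2) (η : Euc 2) =>
      Complex.exp ((2 * Real.pi * ⟪η, p.2⟫_ℝ : ℝ) * Complex.I) • ψ (consPoint (p.1, η))) := by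
    have h1 : Continuous fun q : (ℝ × Euc 2) × Euc 2 =>
        Complex.exp ((2 * Real.pi * ⟪q.2, q.1.2⟫_ℝ : ℝ) * Complex.I) := by fun_prop
    have h2 : Continuous fun q : (ℝ × Euc 2) × Euc 2 => ψ (consPoint (q.1.1, q.2)) :=
      ψ.continuous.comp (continuous_consPoint.comp (by fun_prop))
    exact h1.smul h2
  have h2 := (h.stronglyMeasurable.integral_prod_right (ν := volume)).measurable
  convert h2 using 2 with p
  rw [SchwartzMap.fourierInv_coe, Real.fourierInv_eq']
  rfl

theorem measurable_fourierInv_slice_left (ψ : 𝓢(Euc 3, ℂ)) (x : Euc 2) :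
    Measurable fun t : ℝ => (𝓕⁻ (slice ψ t) : 𝓢(Euc 2, ℂ)) x := by
  have h := (measurable_fourierInv_slice ψ).comp
    (measurable_prodMk_right : Measurable fun t : ℝ => (t, x))
  simpa only [Function.comp_def] using h

/-- The constant in the trace theorem for `H^s`. -/
def traceConst (s : ℝ) : ℝ≥0∞ := ∫⁻ t : ℝ, ENNReal.ofReal ((1 + t ^ 2) ^ (-s))

theorem traceConst_lt_top {s : ℝ} (hs : 1 / 2 < s) : traceConst s < ⊤ := by
  have h := integrable_rpow_neg_one_add_norm_sq (E := ℝ) (μ := volume) (r := 2 * s)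
    (by rw [Module.finrank_self]; push_cast; linarith)
  have h2 : Integrable fun t : ℝ => (1 + t ^ 2) ^ (-s) := by
    convert h using 2 with t
    rw [Real.norm_eq_abs, sq_abs]
    congr 1
    ring
  exact h2.lintegral_lt_top

theorem sq_lintegral_mul_le {X : Type*} [MeasurableSpace X] {μ : Measure X} {f g : X → ℝ≥0∞}
    (hf : AEMeasurable f μ) (hg : AEMeasurable g μ) :
    (∫⁻ x, f x * g x ∂μ) ^ 2 ≤ (∫⁻ x, f x ^ 2 ∂μ) * ∫⁻ x, g x ^ 2 ∂μ := by
  have h := ENNReal.lintegral_mul_le_Lp_mul_Lq μ Real.HolderConjugate.two_two hf hg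
  have h2 := pow_le_pow_left' h 2
  rw [mul_pow, ← ENNReal.rpow_natCast, ← ENNReal.rpow_natCast, ← ENNReal.rpow_natCast,
    ← ENNReal.rpow_mul, ← ENNReal.rpow_mul] at h2
  simpa using h2

/-- Cauchy–Schwarz in the normal frequency with the weights (1 + t²)^(∓s/2). The height a enters
only through a phase, so the bound is uniform in a and may be used with a depending on x. -/
theorem enorm_sq_apply_consPoint_le (s : ℝ) (φ : 𝓢(Euc 3, ℂ)) (a : ℝ) (x : Euc 2) :
    ‖φ (consPoint (a, x))‖ₑ ^ 2 ≤ traceConst s * ∫⁻ t : ℝ, ENNReal.ofReal ((1 + t ^ 2) ^ s) *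
      ‖(𝓕⁻ (slice (𝓕 φ) t) : 𝓢(Euc 2, ℂ)) x‖ₑ ^ 2 := by
  let h : ℝ → ℂ := fun t => (𝓕⁻ (slice (𝓕 φ) t) : 𝓢(Euc 2, ℂ)) x
  have hh : Measurable h := measurable_fourierInv_slice_left (𝓕 φ) x
  have hw : ∀ r : ℝ, Measurable fun t : ℝ => ENNReal.ofReal ((1 + t ^ 2) ^ r) := by
    intro r
    exact ((measurable_const.add (measurable_id.pow_const 2)).pow_const r).ennreal_ofReal
  have h1 : ‖φ (consPoint (a, x))‖ₑ ≤ ∫⁻ t : ℝ, ENNReal.ofReal ((1 + t ^ 2) ^ (-s / 2)) *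
      (ENNReal.ofReal ((1 + t ^ 2) ^ (s / 2)) * ‖h t‖ₑ) := by
    rw [apply_consPoint_eq_integral]
    refine (enorm_integral_le_lintegral_enorm _).trans (lintegral_mono fun t => ?_)
    rw [← mul_assoc (ENNReal.ofReal _), ← ENNReal.ofReal_mul (by positivity), ← Real.rpow_add (by positivity)]
    have : -s / 2 + s / 2 = 0 := by ring
    rw [this, Real.rpow_zero, ENNReal.ofReal_one, one_mul]
    exact (enorm_le_iff_norm_le.2 (norm_exp_ofReal_mul_I_smul _ _).le)
  refine (pow_le_pow_left' h1 2).trans ((sq_lintegral_mul_le (hw _).aemeasurable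
    ((hw _).mul hh.enorm).aemeasurable).trans ?_)
  apply le_of_eq
  congr 1
  · refine lintegral_congr fun t => ?_
    rw [← ENNReal.ofReal_pow (by positivity), ← Real.rpow_mul_natCast (by positivity)]
    congr 2
    push_cast
    ring
  · refine lintegral_congr fun t => ?_
    rw [Pi.mul_apply, mul_pow, ← ENNReal.ofReal_pow (by positivity), ← Real.rpow_mul_natCast (by positivity)]
    congr 3
    push_cast
    ring

/-- The trace estimate on the graph of a measurable function. -/
theorem lintegral_enorm_sq_graphPoint_le {s : ℝ} (hs : 0 ≤ s) (F : Euc 2 → ℝ) (φ : 𝓢(Euc 3, ℂ)) :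
    ∫⁻ x, ‖φ (graphPoint F x)‖ₑ ^ 2 ≤
      traceConst s * ∫⁻ ξ, ENNReal.ofReal ((1 + ‖ξ‖ ^ 2) ^ s) * ‖𝓕 φ ξ‖ₑ ^ 2 := by
  have hm := measurable_fourierInv_slice (𝓕 φ)
  have hw : Measurable fun t : ℝ => ENNReal.ofReal ((1 + t ^ 2) ^ s) := by fun_prop
  have hw3 : Measurable fun ξ : Euc 3 => ENNReal.ofReal ((1 + ‖ξ‖ ^ 2) ^ s) * ‖𝓕 φ ξ‖ₑ ^ 2 := by
    have := (𝓕 φ : 𝓢(Euc 3, ℂ)).continuous.measurable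
    fun_prop
  have hmeas : Measurable (Function.uncurry fun (x : Euc 2) (t : ℝ) =>
      ENNReal.ofReal ((1 + t ^ 2) ^ s) * ‖(𝓕⁻ (slice (𝓕 φ) t) : 𝓢(Euc 2, ℂ)) x‖ₑ ^ 2) :=
    (hw.comp measurable_snd).mul ((hm.comp measurable_swap).enorm.pow_const 2)
  calc ∫⁻ x, ‖φ (graphPoint F x)‖ₑ ^ 2
      ≤ ∫⁻ x, traceConst s * ∫⁻ t : ℝ, ENNReal.ofReal ((1 + t ^ 2) ^ s) *
          ‖(𝓕⁻ (slice (𝓕 φ) t) : 𝓢(Euc 2, ℂ)) x‖ₑ ^ 2 :=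
        lintegral_mono fun x => enorm_sq_apply_consPoint_le s φ (F x) x
    _ = traceConst s * ∫⁻ t : ℝ, ∫⁻ x, ENNReal.ofReal ((1 + t ^ 2) ^ s) *
          ‖(𝓕⁻ (slice (𝓕 φ) t) : 𝓢(Euc 2, ℂ)) x‖ₑ ^ 2 := by
        rw [lintegral_const_mul _ hmeas.lintegral_prod_right,
          lintegral_lintegral_swap hmeas.aemeasurable]
    _ = traceConst s * ∫⁻ t : ℝ, ∫⁻ η, ENNReal.ofReal ((1 + t ^ 2) ^ s) *
          ‖𝓕 φ (consPoint (t, η))‖ₑ ^ 2 := by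
        congr 1
        refine lintegral_congr fun t => ?_
        -- Plancherel in the tangential variables, for fixed t.
        rw [lintegral_const_mul' _ _ ENNReal.ofReal_ne_top, lintegral_enorm_sq_fourierInv,
          ← lintegral_const_mul' _ _ ENNReal.ofReal_ne_top]
        rfl
    _ ≤ traceConst s * ∫⁻ t : ℝ, ∫⁻ η, ENNReal.ofReal ((1 + ‖consPoint (t, η)‖ ^ 2) ^ s) *
          ‖𝓕 φ (consPoint (t, η))‖ₑ ^ 2 := by
        refine mul_le_mul_right (lintegral_mono fun t => lintegral_mono fun η => ?_) _
        have h : t ^ 2 ≤ ‖consPoint (t, η)‖ ^ 2 := by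
          rw [norm_sq_consPoint]
          exact le_add_of_nonneg_right (sq_nonneg ‖η‖)
        refine mul_le_mul_left (ENNReal.ofReal_le_ofReal ?_) _
        exact Real.rpow_le_rpow (by positivity) (by linarith) hs
    _ = _ := by
        congr 1
        rw [← measurePreserving_consPoint.lintegral_comp hw3]
        exact (lintegral_prod _ (hw3.comp measurePreserving_consPoint.measurable).aemeasurable).symm

end

/-! ### Traces on Sobolev spaces and their agreement off the support -/

section

open scoped FourierTransform InnerProductSpace ENNReal

/-- By Plancherel, the right-hand side of the trace estimate is exactly the squared H^s norm. -/
theorem Sobolev.enorm_ofSchwartz_sq (s : ℝ) (φ : 𝓢(Euc 3, ℂ)) :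
    ‖Sobolev.ofSchwartz s φ‖ₑ ^ 2 =
      ∫⁻ ξ, ENNReal.ofReal ((1 + ‖ξ‖ ^ 2) ^ s) * ‖𝓕 φ ξ‖ₑ ^ 2 := by
  have h1 : ‖Sobolev.ofSchwartz s φ‖ₑ =
      eLpNorm (Sobolev.besselSchwartz 3 s φ : 𝓢(Euc 3, ℂ)) 2 volume := by
    rw [← ofReal_norm, Sobolev.norm_def, Sobolev.bessel_ofSchwartz, SchwartzMap.toLpCLM_apply,
      ofReal_norm, SchwartzMap.toLp, Lp.enorm_toLp]
  rw [h1, ← lintegral_enorm_sq_eq, Sobolev.besselSchwartz, SchwartzMap.fourierMultiplierCLM_apply,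
    lintegral_enorm_sq_fourierInv]
  refine lintegral_congr fun ξ => ?_
  rw [SchwartzMap.smulLeftCLM_apply_apply (by fun_prop), enorm_smul, mul_pow]
  congr 1
  rw [← ofReal_norm, Complex.norm_real, Real.norm_of_nonneg (by positivity),
    ← ENNReal.ofReal_pow (by positivity), ← Real.rpow_mul_natCast (by positivity)]
  congr 2
  push_cast
  ring

theorem continuous_graphPoint {F : Euc 2 → ℝ} (hF : Continuous F) : Continuous (graphPoint F) :=
  continuous_consPoint.comp (hF.prodMk continuous_id)

theorem eLpNorm_comp_graphPoint_sq_le {s : ℝ} (hs : 0 ≤ s) (F : Euc 2 → ℝ) (φ : 𝓢(Euc 3, ℂ)) :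
    eLpNorm (fun x => φ (graphPoint F x)) 2 volume ^ 2 ≤
      traceConst s * ‖Sobolev.ofSchwartz s φ‖ₑ ^ 2 := by
  rw [← lintegral_enorm_sq_eq, Sobolev.enorm_ofSchwartz_sq]
  exact lintegral_enorm_sq_graphPoint_le hs F φ

theorem eLpNorm_comp_graphPoint_le {s : ℝ} (hs : 1 / 2 < s) (F : Euc 2 → ℝ) (φ : 𝓢(Euc 3, ℂ)) :
    eLpNorm (fun x => φ (graphPoint F x)) 2 volume ≤
      ENNReal.ofReal (Real.sqrt (traceConst s).toReal * ‖Sobolev.ofSchwartz s φ‖) := by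
  have h := eLpNorm_comp_graphPoint_sq_le (by linarith : 0 ≤ s) F φ
  rw [← ENNReal.ofReal_toReal (traceConst_lt_top hs).ne, ← ofReal_norm,
    ← ENNReal.ofReal_pow (norm_nonneg _), ← ENNReal.ofReal_mul ENNReal.toReal_nonneg] at h
  refine (ENNReal.pow_le_pow_left_iff two_ne_zero).1 (h.trans ?_)
  rw [← ENNReal.ofReal_pow (by positivity), mul_pow, Real.sq_sqrt ENNReal.toReal_nonneg]

theorem memLp_comp_graphPoint {F : Euc 2 → ℝ} (hF : Continuous F) (φ : 𝓢(Euc 3, ℂ)) :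
    MemLp (fun x => φ (graphPoint F x)) 2 volume :=
  ⟨(φ.continuous.comp (continuous_graphPoint hF)).aestronglyMeasurable,
    (eLpNorm_comp_graphPoint_le (s := 1) (by norm_num) F φ).trans_lt ENNReal.ofReal_lt_top⟩

/-- The evaluation of Schwartz functions on the graph of `F`. -/
def schwartzTrace {F : Euc 2 → ℝ} (hF : Continuous F) : 𝓢(Euc 3, ℂ) →ₗ[ℂ] L2 2 where
  toFun φ := (memLp_comp_graphPoint hF φ).toLp _
  map_add' _ _ := rfl
  map_smul' _ _ := rfl

theorem coeFn_schwartzTrace {F : Euc 2 → ℝ} (hF : Continuous F) (φ : 𝓢(Euc 3, ℂ)) :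
    schwartzTrace hF φ =ᵐ[volume] fun x => φ (graphPoint F x) :=
  (memLp_comp_graphPoint hF φ).coeFn_toLp

theorem norm_schwartzTrace_le {F : Euc 2 → ℝ} (hF : Continuous F) {s : ℝ} (hs : 1 / 2 < s)
    (φ : 𝓢(Euc 3, ℂ)) :
    ‖schwartzTrace hF φ‖ ≤
      Real.sqrt (traceConst s).toReal * ‖Sobolev.ofSchwartzCLM 3 s φ‖ := by
  rw [Sobolev.ofSchwartzCLM_apply]
  refine (Lp.norm_toLp _ (memLp_comp_graphPoint hF φ)).trans_le ?_
  exact ENNReal.toReal_le_of_le_ofReal (by positivity) (eLpNorm_comp_graphPoint_le hs F φ)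

/-- Extension by continuity from the dense image of the Schwartz space, where the trace estimate
bounds the evaluation in the H^s norm. -/
theorem exists_isTrace {F : Euc 2 → ℝ} (hF : Continuous F) {s : ℝ} (hs : 1 / 2 < s) :
    ∃ T, IsTrace F s T := by
  refine ⟨(schwartzTrace hF).extendOfNorm (Sobolev.ofSchwartzCLM 3 s).toLinearMap,
    fun φ _ => ?_⟩
  have h := LinearMap.extendOfNorm_eq (f := schwartzTrace hF)
    (e := (Sobolev.ofSchwartzCLM 3 s).toLinearMap) Sobolev.denseRange_ofSchwartzCLM
    ⟨_, norm_schwartzTrace_le hF hs⟩ φ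
  rw [ContinuousLinearMap.coe_coe, Sobolev.ofSchwartzCLM_apply] at h
  rw [h]
  exact coeFn_schwartzTrace hF φ

theorem IsTrace.unique {F : Euc 2 → ℝ} {s : ℝ} {T T' : Sobolev 3 s →L[ℂ] L2 2}
    (h : IsTrace F s T) (h' : IsTrace F s T') : T = T' := by
  apply DFunLike.coe_injective
  refine Sobolev.ext_of_hasCompactSupport T.continuous T'.continuous fun φ hφ => ?_
  exact Lp.ext ((h φ hφ).trans (h' φ hφ).symm)

theorem isTrace_trace {F : Euc 2 → ℝ} (hF : Continuous F) {s : ℝ} (hs : 1 / 2 < s) :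
    IsTrace F s (trace F s) := by
  have h := exists_isTrace hF hs
  rw [trace, dif_pos h]
  exact h.choose_spec

theorem existsUnique_isTrace {F : Euc 2 → ℝ} (hF : Continuous F) {s : ℝ} (hs : 1 / 2 < s) :
    ∃! T, IsTrace F s T :=
  ⟨_, isTrace_trace hF hs, fun _ h => h.unique (isTrace_trace hF hs)⟩

section Family

variable {K : Type} [NormedAddCommGroup K] [NormedSpace ℂ K] {s t : ℝ}

/-- A bounded operator on `H^s(ℝ³)`, transported to `L²(ℝ³)` by the Bessel potential. -/
def onL2 (τ : Sobolev 3 s →L[ℂ] K) : L2 3 →L[ℂ] K :=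
  τ ∘L (Sobolev.besselEquiv 3 s).symm.toContinuousLinearEquiv.toContinuousLinearMap

theorem onL2_bessel (τ : Sobolev 3 s →L[ℂ] K) (u : Sobolev 3 s) : onL2 τ (Sobolev.bessel u) = τ u :=
  congrArg τ ((Sobolev.besselEquiv 3 s).symm_apply_apply u)

/-- A family of operators on the Sobolev spaces of order `s > 1/2`, in which each operator is the
restriction of those on larger spaces. -/
def IsConsistent (τ : ∀ s : ℝ, Sobolev 3 s →L[ℂ] K) : Prop :=
  ∀ s t : ℝ, 1 / 2 < s → s ≤ t → onL2 (τ t) = onL2 (τ s) ∘L besselInv 3 (t - s)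

/-- The trace on H^s restricted to H^t also extends the evaluation of test functions, so uniqueness
makes it the trace on H^t. -/
theorem isConsistent_trace {F : Euc 2 → ℝ} (hF : Continuous F) : IsConsistent (trace F) := by
  intro s t hs hst
  let T : Sobolev 3 t →L[ℂ] L2 2 := (onL2 (trace F s) ∘L besselInv 3 (t - s)) ∘L
    (Sobolev.besselEquiv 3 t).toContinuousLinearEquiv.toContinuousLinearMap
  have hT : IsTrace F t T := by
    intro φ hφ
    have h : T (Sobolev.ofSchwartz t φ) = trace F s (Sobolev.ofSchwartz s φ) := by
      have h1 : besselInv 3 (t - s) (Sobolev.bessel (Sobolev.ofSchwartz t φ)) =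
        Sobolev.bessel (Sobolev.ofSchwartz s φ) := Sobolev.besselInv_bessel hst rfl
      rw [← onL2_bessel (trace F s), ← h1]
      rfl
    rw [h]
    exact isTrace_trace hF hs φ hφ
  have h := (isTrace_trace hF (hs.trans_le hst)).unique hT
  rw [h]
  ext1 g
  exact congrArg (onL2 (trace F s) ∘L besselInv 3 (t - s))
    ((Sobolev.besselEquiv 3 t).apply_symm_apply g)

end Family

/-- The restriction of the pair of functions in `L²(ℝ²)` to `S`. -/
def restrictPair (S : Set (Euc 2)) : (L2 2 × L2 2) →L[ℂ] L2Pair S :=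
  (WithLp.prodContinuousLinearEquiv 2 ℂ (L2On S) (L2On S)).symm.toContinuousLinearMap ∘L
    (LpToLpRestrictCLM (Euc 2) ℂ ℂ volume 2 S).prodMap
      (LpToLpRestrictCLM (Euc 2) ℂ ℂ volume 2 S)

theorem onL2_tracePair (F : Euc 2 → ℝ) (s : ℝ) :
    onL2 (tracePair F s) =
      restrictPair (tsupport F) ∘L ((onL2 (trace F s)).prod (onL2 (trace 0 s))) := rfl

theorem isConsistent_tracePair {F : Euc 2 → ℝ} (hF : Continuous F) :
    IsConsistent (tracePair F) := by
  intro s t hs hst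
  rw [onL2_tracePair, onL2_tracePair, isConsistent_trace hF s t hs hst,
    isConsistent_trace continuous_zero s t hs hst]
  rfl

/-- Off the support of `F`, the traces on the graphs of `F` and of `0` agree. -/
theorem trace_ae_eq_trace_zero {F : Euc 2 → ℝ} (hF : Continuous F) {s : ℝ} (hs : 1 / 2 < s)
    (u : Sobolev 3 s) :
    trace F s u =ᵐ[volume.restrict (tsupport F)ᶜ] trace 0 s u := by
  let P := LpToLpRestrictCLM (Euc 2) ℂ ℂ volume 2 (tsupport F)ᶜ
  have h : (P ∘L trace F s : Sobolev 3 s → L2On (tsupport F)ᶜ) = P ∘L trace 0 s := by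
    refine Sobolev.ext_of_hasCompactSupport (P ∘L trace F s).continuous
      (P ∘L trace 0 s).continuous fun φ hφ => ?_
    apply Lp.ext
    have h1 := LpToLpRestrictCLM_coeFn ℂ (tsupport F)ᶜ (trace F s (Sobolev.ofSchwartz s φ))
    have h2 := LpToLpRestrictCLM_coeFn ℂ (tsupport F)ᶜ (trace 0 s (Sobolev.ofSchwartz s φ))
    have h3 := ae_restrict_of_ae (s := (tsupport F)ᶜ) (isTrace_trace hF hs φ hφ)
    have h4 := ae_restrict_of_ae (s := (tsupport F)ᶜ)
      (isTrace_trace (F := 0) continuous_zero hs φ hφ)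
    filter_upwards [h1, h2, h3, h4,
      ae_restrict_mem (isClosed_tsupport F).isOpen_compl.measurableSet] with x h1 h2 h3 h4 hx
    refine h1.trans (h3.trans (Eq.trans ?_ (h2.trans h4).symm))
    have : F x = 0 := image_eq_zero_of_notMem_tsupport hx
    simp only [graphPoint, this, Pi.zero_apply]
  have hu := congrFun h u
  filter_upwards [LpToLpRestrictCLM_coeFn ℂ (tsupport F)ᶜ (trace F s u),
    LpToLpRestrictCLM_coeFn ℂ (tsupport F)ᶜ (trace 0 s u)] with x h1 h2
  rw [← h1, ← h2]
  exact congrArg (fun f : L2On (tsupport F)ᶜ => f x) hu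

theorem inner_restrict (S : Set (Euc 2)) (f g : L2 2) :
    ⟪LpToLpRestrictCLM (Euc 2) ℂ ℂ volume 2 S f, LpToLpRestrictCLM (Euc 2) ℂ ℂ volume 2 S g⟫_ℂ =
      ∫ x in S, ⟪f x, g x⟫_ℂ := by
  rw [L2.inner_def]
  apply integral_congr_ae
  filter_upwards [LpToLpRestrictCLM_coeFn ℂ S f, LpToLpRestrictCLM_coeFn ℂ S g] with x h1 h2
  rw [h1, h2]

/-- Splitting the inner products of L²(ℝ²) over Σ and its complement, the contributions of the
complement cancel because the traces agree there; the sign in J records the subtraction on Σ. -/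
theorem inner_sub_inner_trace {F : Euc 2 → ℝ} (hF : Continuous F) {s : ℝ} (hs : 1 / 2 < s)
    (u v : Sobolev 3 s) :
    ⟪tracePair F s u, signJ (tsupport F) (tracePair F s v)⟫_ℂ =
      ⟪trace F s u, trace F s v⟫_ℂ - ⟪trace 0 s u, trace 0 s v⟫_ℂ := by
  have hS : MeasurableSet (tsupport F) := (isClosed_tsupport F).measurableSet
  have h1 : ⟪tracePair F s u, signJ (tsupport F) (tracePair F s v)⟫_ℂ =
      (∫ x in tsupport F, ⟪trace F s u x, trace F s v x⟫_ℂ) -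
        ∫ x in tsupport F, ⟪trace 0 s u x, trace 0 s v x⟫_ℂ := by
    rw [← inner_restrict, ← inner_restrict, sub_eq_add_neg, ← inner_neg_right]
    exact WithLp.prod_inner_apply _ _
  have h2 : ∀ f g : L2 2, ⟪f, g⟫_ℂ = (∫ x in tsupport F, ⟪f x, g x⟫_ℂ) +
      ∫ x in (tsupport F)ᶜ, ⟪f x, g x⟫_ℂ := fun f g =>
    (integral_add_compl hS (L2.integrable_inner (𝕜 := ℂ) f g)).symm
  have h3 : ∫ x in (tsupport F)ᶜ, ⟪trace F s u x, trace F s v x⟫_ℂ =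
      ∫ x in (tsupport F)ᶜ, ⟪trace 0 s u x, trace 0 s v x⟫_ℂ := by
    apply integral_congr_ae
    filter_upwards [trace_ae_eq_trace_zero hF hs u, trace_ae_eq_trace_zero hF hs v] with x h h'
    rw [h, h']
  rw [h1, h2 (trace F s u), h2 (trace 0 s u), h3]
  ring

end

/-! ### The free resolvent as a Fourier multiplier -/

section

open scoped FourierTransform InnerProductSpace BoundedContinuousFunction

/-- The complement of the half-line `[0, ∞)`, i.e. the resolvent set of the free Laplacian. -/
def IsOffHalfLine (z : ℂ) : Prop := z ∉ ((fun t : ℝ => (t : ℂ)) '' Set.Ici 0)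

theorem IsOffHalfLine.conj {z : ℂ} (hz : IsOffHalfLine z) : IsOffHalfLine (conj z) := by
  rintro ⟨t, ht, h⟩
  refine hz ⟨t, ht, ?_⟩
  have := congrArg (starRingEnd ℂ) h
  simpa using this

/-- A square root of -z on the imaginary axis would put z on [0, ∞); otherwise one of ±c has
positive real part. -/
theorem IsOffHalfLine.exists_sqrt_neg {z : ℂ} (hz : IsOffHalfLine z) :
    ∃ c : ℂ, c ^ 2 = -z ∧ 0 < c.re := by
  obtain ⟨c, hc⟩ := IsAlgClosed.exists_pow_nat_eq (-z) two_pos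
  rcases lt_trichotomy c.re 0 with h | h | h
  · exact ⟨-c, by rw [neg_sq, hc], by simpa using h⟩
  · refine absurd ⟨c.im ^ 2, Set.mem_Ici.2 (sq_nonneg _), ?_⟩ hz
    have hc' : c = c.im * Complex.I := by
      apply Complex.ext <;> simp [h]
    have : z = -c ^ 2 := by rw [hc, neg_neg]
    rw [this]
    conv_rhs => rw [hc']
    rw [mul_pow, Complex.I_sq]
    push_cast
    ring
  · exact ⟨c, hc, h⟩

/-- Since conj(p - z) = p + c̄², the product is pc + |c|²c̄. This identity gives both the lower
bound on |p - z| and the sign needed to invert Γ. -/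
theorem re_mul_conj_sub {c z : ℂ} (hc : c ^ 2 = -z) (p : ℝ) :
    (c * conj ((p : ℂ) - z)).re = (p + ‖c‖ ^ 2) * c.re := by
  have hz : z = -c ^ 2 := by rw [hc, neg_neg]
  rw [hz, ← Complex.normSq_eq_norm_sq, Complex.normSq_apply]
  simp only [sq, map_sub, map_neg, map_mul, Complex.conj_ofReal, Complex.mul_re, Complex.sub_re,
    Complex.sub_im, Complex.neg_re, Complex.neg_im, Complex.mul_im, Complex.conj_re,
    Complex.conj_im, Complex.ofReal_re, Complex.ofReal_im]
  ring

theorem IsOffHalfLine.sub_ne_zero {z : ℂ} (hz : IsOffHalfLine z) {p : ℝ} (hp : 0 ≤ p) :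
    (p : ℂ) - z ≠ 0 := fun h => hz ⟨p, hp, _root_.sub_eq_zero.1 h⟩

theorem IsOffHalfLine.exists_le_norm_sub {z : ℂ} (hz : IsOffHalfLine z) :
    ∃ ε : ℝ, 0 < ε ∧ ∀ p : ℝ, 0 ≤ p → ε * (1 + p) ≤ ‖(p : ℂ) - z‖ := by
  obtain ⟨c, hc, hre⟩ := hz.exists_sqrt_neg
  have hc0 : 0 < ‖c‖ := norm_pos_iff.2 fun h => by simp [h] at hre
  refine ⟨min 1 (‖c‖ ^ 2) * c.re / ‖c‖, by positivity, fun p hp => ?_⟩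
  rw [div_mul_eq_mul_div, div_le_iff₀ hc0]
  calc min 1 (‖c‖ ^ 2) * c.re * (1 + p)
      = (min 1 (‖c‖ ^ 2) * p + min 1 (‖c‖ ^ 2)) * c.re := by ring
    _ ≤ (1 * p + ‖c‖ ^ 2) * c.re := by
        gcongr
        · exact min_le_left _ _
        · exact min_le_right _ _
    _ = (c * conj ((p : ℂ) - z)).re := by rw [re_mul_conj_sub hc, one_mul]
    _ ≤ ‖c * conj ((p : ℂ) - z)‖ := Complex.re_le_norm _
    _ = ‖(p : ℂ) - z‖ * ‖c‖ := by rw [norm_mul, RCLike.norm_conj, mul_comm]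

/-- The symbol `|ξ|² / (1 + |ξ|²)`. -/
def ratioSymbol : Euc 3 →ᵇ ℂ :=
  BoundedContinuousFunction.ofNormedAddCommGroup
    (fun ξ => ((‖ξ‖ ^ 2 / (1 + ‖ξ‖ ^ 2) : ℝ) : ℂ))
    (Complex.continuous_ofReal.comp (Continuous.div (by fun_prop) (by fun_prop)
      fun ξ => (by positivity))) 1 (by
      intro ξ
      rw [Complex.norm_real, Real.norm_of_nonneg (by positivity)]
      exact div_le_one_of_le₀ (by linarith) (by positivity))

/-- The symbol `((2π)²|ξ|² - z) / (1 + |ξ|²)`. -/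
def energySymbol (z : ℂ) : Euc 3 →ᵇ ℂ :=
  (((2 * Real.pi) ^ 2 : ℝ) : ℂ) • ratioSymbol - z • besselSymbol 3 2

theorem energySymbol_apply (z : ℂ) (ξ : Euc 3) :
    energySymbol z ξ =
      (((2 * Real.pi) ^ 2 * ‖ξ‖ ^ 2 : ℝ) - z) / ((1 + ‖ξ‖ ^ 2 : ℝ) : ℂ) := by
  rw [energySymbol, BoundedContinuousFunction.sub_apply, BoundedContinuousFunction.smul_apply,
    BoundedContinuousFunction.smul_apply, besselSymbol_apply zero_le_two, ratioSymbol,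
    BoundedContinuousFunction.coe_ofNormedAddCommGroup, neg_div, div_self two_ne_zero,
    Real.rpow_neg_one, smul_eq_mul, smul_eq_mul]
  push_cast
  ring

/-- The symbol `(1 + |ξ|²) / ((2π)²|ξ|² - z)`, for `z` off the half-line `[0, ∞)`. -/
def greenSymbol {z : ℂ} (hz : IsOffHalfLine z) : Euc 3 →ᵇ ℂ :=
  BoundedContinuousFunction.ofNormedAddCommGroup
    (fun ξ => ((1 + ‖ξ‖ ^ 2 : ℝ) : ℂ) / (((2 * Real.pi) ^ 2 * ‖ξ‖ ^ 2 : ℝ) - z))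
    (Continuous.div (by fun_prop) (by fun_prop) fun ξ => hz.sub_ne_zero (by positivity))
    (hz.exists_le_norm_sub.choose)⁻¹ (by
      intro ξ
      obtain ⟨hε, h⟩ := hz.exists_le_norm_sub.choose_spec
      have h1 := h ((2 * Real.pi) ^ 2 * ‖ξ‖ ^ 2) (by positivity)
      have h2 : 1 + ‖ξ‖ ^ 2 ≤ 1 + (2 * Real.pi) ^ 2 * ‖ξ‖ ^ 2 := by
        have : 1 ≤ (2 * Real.pi) ^ 2 := by nlinarith [Real.pi_gt_three]
        nlinarith [sq_nonneg ‖ξ‖]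
      rw [norm_div, Complex.norm_real, Real.norm_of_nonneg (by positivity),
        div_le_iff₀ (norm_pos_iff.2 (hz.sub_ne_zero (by positivity)))]
      calc 1 + ‖ξ‖ ^ 2 ≤ 1 + (2 * Real.pi) ^ 2 * ‖ξ‖ ^ 2 := h2
        _ = (hz.exists_le_norm_sub.choose)⁻¹ * (hz.exists_le_norm_sub.choose *
            (1 + (2 * Real.pi) ^ 2 * ‖ξ‖ ^ 2)) := by
            rw [← mul_assoc, inv_mul_cancel₀ hε.ne', one_mul]
        _ ≤ _ := by gcongr)

variable {z : ℂ}

theorem greenSymbol_apply (hz : IsOffHalfLine z) (ξ : Euc 3) :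
    greenSymbol hz ξ =
      ((1 + ‖ξ‖ ^ 2 : ℝ) : ℂ) / (((2 * Real.pi) ^ 2 * ‖ξ‖ ^ 2 : ℝ) - z) := rfl

theorem energySymbol_mul_greenSymbol (hz : IsOffHalfLine z) :
    energySymbol z * greenSymbol hz = 1 := by
  ext ξ
  rw [BoundedContinuousFunction.mul_apply, energySymbol_apply, greenSymbol_apply]
  have h1 := hz.sub_ne_zero (p := (2 * Real.pi) ^ 2 * ‖ξ‖ ^ 2) (by positivity)
  have h2 : ((1 + ‖ξ‖ ^ 2 : ℝ) : ℂ) ≠ 0 := by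
    rw [Complex.ofReal_ne_zero]
    positivity
  rw [div_mul_div_comm, mul_comm, div_self (mul_ne_zero h2 h1)]
  rfl

theorem star_greenSymbol (hz : IsOffHalfLine z) : star (greenSymbol hz) = greenSymbol hz.conj := by
  ext ξ
  rw [BoundedContinuousFunction.star_apply, greenSymbol_apply, greenSymbol_apply, RCLike.star_def,
    map_div₀, map_sub, Complex.conj_ofReal, Complex.conj_ofReal]

/-- The bounded operator in `L²(ℝ³)` with symbol `(1 + |ξ|²) / ((2π)²|ξ|² - z)`. -/
def green (hz : IsOffHalfLine z) : L2 3 →L[ℂ] L2 3 := fourierMul (greenSymbol hz)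

/-- The bounded operator in `L²(ℝ³)` with symbol `((2π)²|ξ|² - z) / (1 + |ξ|²)`. -/
def energy (z : ℂ) : L2 3 →L[ℂ] L2 3 := fourierMul (energySymbol z)

theorem energy_comp_green (hz : IsOffHalfLine z) : energy z ∘L green hz = 1 := by
  rw [energy, green, ← fourierMul_mul, energySymbol_mul_greenSymbol, fourierMul_one]

theorem green_comp_energy (hz : IsOffHalfLine z) : green hz ∘L energy z = 1 := by
  rw [energy, green, fourierMul_comm, ← fourierMul_mul, energySymbol_mul_greenSymbol,
    fourierMul_one]

theorem adjoint_green (hz : IsOffHalfLine z) :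
    ContinuousLinearMap.adjoint (green hz) = green hz.conj := by
  rw [green, adjoint_fourierMul, star_greenSymbol]
  rfl

theorem green_comp_besselInv (hz : IsOffHalfLine z) (s : ℝ) :
    green hz ∘L besselInv 3 s = besselInv 3 s ∘L green hz := fourierMul_comm _ _

/-- The symbol c(1 + |ξ|²)/(p - z), p = (2π)²|ξ|², has nonnegative real part by `re_mul_conj_sub`;
Plancherel transfers this to the operator. -/
theorem re_mul_inner_green_nonneg (hz : IsOffHalfLine z) {c : ℂ} (hc : c ^ 2 = -z)
    (hre : 0 < c.re) (f : L2 3) : 0 ≤ (conj c * ⟪green hz f, f⟫_ℂ).re := by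
  rw [← inner_smul_left]
  have h : c • green hz f = fourierMul (c • greenSymbol hz) f := by
    rw [fourierMul_smul]
    rfl
  rw [h]
  refine re_inner_fourierMul_nonneg (fun ξ => ?_) f
  rw [BoundedContinuousFunction.smul_apply, greenSymbol_apply, smul_eq_mul, mul_div_left_comm,
    Complex.re_ofReal_mul]
  refine mul_nonneg (by positivity) ?_
  rw [div_eq_mul_inv, Complex.inv_def, ← mul_assoc, Complex.re_mul_ofReal, re_mul_conj_sub hc]
  have := Complex.normSq_nonneg ((((2 * Real.pi) ^ 2 * ‖ξ‖ ^ 2 : ℝ) : ℂ) - z)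
  positivity

theorem besselInv_two_mem (g : L2 3) : besselInv 3 2 g ∈ (freeLaplacian 3).domain :=
  ⟨g, besselPotential_distr_besselInv zero_le_two g⟩

theorem exists_eq_besselInv_two {u : L2 3} (hu : u ∈ (freeLaplacian 3).domain) : ∃ g, besselInv 3 2 g = u := by
  obtain ⟨g, hg⟩ := hu
  refine ⟨g, distr_injective 3 ?_⟩
  rw [distr_besselInv zero_le_two, besselPotential_neg_apply_eq_iff]
  exact hg

theorem distr_freeLaplacian (u : (freeLaplacian 3).domain) :
    distr 3 (freeLaplacian 3 u) = -Δ (distr 3 (u : L2 3)) :=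
  (distr_liftL2 _ _ _).trans (negLaplacian_apply u)

/-- Parametrising H² by `besselInv 3 2` turns -Δ - z into the bounded operator `energy z`; the
factor (2π)² comes from the normalisation of the Fourier transform. -/
theorem freeLaplacian_besselInv_two (g : L2 3) :
    freeLaplacian 3 ⟨besselInv 3 2 g, besselInv_two_mem g⟩ - z • besselInv 3 2 g = energy z g := by
  have h : freeLaplacian 3 ⟨besselInv 3 2 g, besselInv_two_mem g⟩ =
      (((2 * Real.pi) ^ 2 : ℝ) : ℂ) • fourierMul ratioSymbol g := by
    apply distr_injective
    rw [distr_freeLaplacian]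
    change -Δ (distr 3 (besselInv 3 2 g)) = _
    rw [TemperedDistribution.laplacian_eq_fourierMultiplierCLM, map_smul]
    have h2 := fourierMultiplierCLM_distr_fourierMul (a := fun x : Euc 3 => ((‖x‖ ^ 2 : ℝ) : ℂ))
      (by fun_prop) (m := besselSymbol 3 2) (n := ratioSymbol) (fun ξ => by
        rw [besselSymbol_apply zero_le_two, neg_div, div_self two_ne_zero, Real.rpow_neg_one,
          ← Complex.ofReal_mul]
        rfl) g
    rw [besselInv, h2, neg_smul, neg_neg]
    ext φ
    exact (Complex.coe_smul ((2 * Real.pi) ^ 2) (distr 3 (fourierMul ratioSymbol g) φ)).symm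
  rw [h, energy, energySymbol, fourierMul_sub, fourierMul_smul, fourierMul_smul]
  rfl

theorem isResolvent_green (hz : IsOffHalfLine z) :
    IsResolvent (freeLaplacian 3) z (besselInv 3 2 ∘L green hz) := by
  constructor
  · intro f
    refine ⟨besselInv_two_mem _, ?_⟩
    refine (freeLaplacian_besselInv_two (z := z) (green hz f)).trans ?_
    exact DFunLike.congr_fun (energy_comp_green hz) f
  · rintro ⟨u, hu⟩
    obtain ⟨g, rfl⟩ := exists_eq_besselInv_two hu
    rw [freeLaplacian_besselInv_two, ContinuousLinearMap.comp_apply]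
    exact congrArg (besselInv 3 2) (DFunLike.congr_fun (green_comp_energy hz) g)

theorem IsResolvent.unique {H : Type} [NormedAddCommGroup H] [NormedSpace ℂ H] {A : H →ₗ.[ℂ] H}
    {R R' : H →L[ℂ] H} (h : IsResolvent A z R) (h' : IsResolvent A z R') : R = R' := by
  ext1 f
  obtain ⟨hf, hAf⟩ := h.1 f
  have h2 : R' (A ⟨R f, hf⟩ - z • R f) = R f := h'.2 ⟨R f, hf⟩
  rw [← h2, hAf]

theorem isResolvent_freeResolvent (hz : IsOffHalfLine z) :
    IsResolvent (freeLaplacian 3) z (freeResolvent z) := by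
  have h : ∃ R, IsResolvent (freeLaplacian 3) z R := ⟨_, isResolvent_green hz⟩
  rw [freeResolvent, resolventAt, dif_pos h]
  exact h.choose_spec

theorem freeResolvent_eq (hz : IsOffHalfLine z) : freeResolvent z = besselInv 3 2 ∘L green hz :=
  (isResolvent_freeResolvent hz).unique (isResolvent_green hz)

end

/-! ### Krein's formula, perturbation of inverses, and coercivity -/

section

open scoped InnerProductSpace
open ContinuousLinearMap (adjoint)

section Algebra

variable {H K : Type*} [NormedAddCommGroup H] [NormedSpace ℂ H] [NormedAddCommGroup K]
  [NormedSpace ℂ K]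

theorem ringInverse_comp_apply {N : K →L[ℂ] K} (h : IsUnit N) (x : K) :
    Ring.inverse N (N x) = x :=
  DFunLike.congr_fun (Ring.inverse_mul_cancel N h) x

theorem comp_ringInverse_apply {N : K →L[ℂ] K} (h : IsUnit N) (x : K) :
    N (Ring.inverse N x) = x :=
  DFunLike.congr_fun (Ring.mul_inverse_cancel N h) x

/-- Krein's formula for the inverse of `A⁻¹ + α S T`. -/
def kreinInverse (α : ℂ) (A : H →L[ℂ] H) (T : H →L[ℂ] K) (S : K →L[ℂ] H) : H →L[ℂ] H :=
  A - α • (A ∘L S ∘L Ring.inverse (1 + α • (T ∘L A ∘L S)) ∘L T ∘L A)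

variable {α : ℂ} {A B : H →L[ℂ] H} {T : H →L[ℂ] K} {S : K →L[ℂ] H}

theorem kreinInverse_apply (f : H) :
    kreinInverse α A T S f =
      A f - α • A (S (Ring.inverse (1 + α • (T ∘L A ∘L S)) (T (A f)))) := rfl

theorem comp_kreinInverse (hBA : B ∘L A = 1) (hΓ : IsUnit (1 + α • (T ∘L A ∘L S))) :
    (B + α • (S ∘L T)) ∘L kreinInverse α A T S = 1 := by
  ext1 f
  have h1 : ∀ g, B (A g) = g := fun g => DFunLike.congr_fun hBA g
  -- With k = Γ⁻¹TAf this says k + αTASk = TAf, which is all that the cancellation uses.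
  have h2 : Ring.inverse (1 + α • (T ∘L A ∘L S)) (T (A f)) +
      α • T (A (S (Ring.inverse (1 + α • (T ∘L A ∘L S)) (T (A f))))) = T (A f) :=
    comp_ringInverse_apply hΓ (T (A f))
  have h3 : (B + α • (S ∘L T)) (kreinInverse α A T S f) =
      B (kreinInverse α A T S f) + α • S (T (kreinInverse α A T S f)) := rfl
  rw [ContinuousLinearMap.comp_apply, h3, kreinInverse_apply]
  generalize Ring.inverse (1 + α • (T ∘L A ∘L S)) (T (A f)) = k at h2 ⊢
  change _ = f
  simp only [map_sub, map_smul, h1]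
  rw [← h2]
  simp only [map_add, map_smul]
  module

theorem kreinInverse_comp (hAB : A ∘L B = 1) (hΓ : IsUnit (1 + α • (T ∘L A ∘L S))) :
    kreinInverse α A T S ∘L (B + α • (S ∘L T)) = 1 := by
  ext1 f
  have h1 : ∀ g, A (B g) = g := fun g => DFunLike.congr_fun hAB g
  have h2 : Ring.inverse (1 + α • (T ∘L A ∘L S)) (T f + α • T (A (S (T f)))) = T f :=
    ringInverse_comp_apply hΓ (T f)
  have h3 : (B + α • (S ∘L T)) f = B f + α • S (T f) := rfl
  rw [ContinuousLinearMap.comp_apply, h3, kreinInverse_apply]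
  change _ = f
  have h4 : T (A (B f + α • S (T f))) = T f + α • T (A (S (T f))) := by
    simp only [map_add, map_smul, h1]
  rw [h4, h2, map_add, map_smul, h1, add_sub_cancel_right]

variable {H₀ H₁ Q₀ Q₁ : H →L[ℂ] H} {J : K →L[ℂ] K}

/-- This is Q₀(H₁ - H₀)Q₁ expanded in two ways; only one one-sided inverse of each operator is
needed. -/
theorem resolvent_identity (h₀ : Q₀ ∘L H₀ = 1) (h₁ : H₁ ∘L Q₁ = 1)
    (h : H₁ - H₀ = α • (S ∘L J ∘L T)) (f : H) :
    Q₀ f - Q₁ f = α • Q₀ (S (J (T (Q₁ f)))) := by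
  have e1 : H₁ (Q₁ f) = f := DFunLike.congr_fun h₁ f
  have e2 : Q₀ (H₀ (Q₁ f)) = Q₁ f := DFunLike.congr_fun h₀ (Q₁ f)
  have e3 : H₁ (Q₁ f) - H₀ (Q₁ f) = α • S (J (T (Q₁ f))) := DFunLike.congr_fun h (Q₁ f)
  rw [← map_smul, ← e3, map_sub, e1, e2]

/-- Applying JT on the left and S on the right of the resolvent identity makes the terms of first
and second order in α cancel. -/
theorem perturbation_mul_eq_one (h₀ : Q₀ ∘L H₀ = 1) (h₁ : H₁ ∘L Q₁ = 1)
    (h : H₁ - H₀ = α • (S ∘L J ∘L T)) :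
    (1 + α • (J ∘L T ∘L Q₀ ∘L S)) * (1 - α • (J ∘L T ∘L Q₁ ∘L S)) = 1 := by
  ext1 k
  have e := congrArg (fun g => α • J (T g)) (resolvent_identity h₀ h₁ h (S k))
  simp only [map_sub, map_smul, smul_sub] at e
  change (k - α • J (T (Q₁ (S k)))) + α • J (T (Q₀ (S (k - α • J (T (Q₁ (S k))))))) = k
  simp only [map_sub, map_smul, smul_sub]
  rw [← e]
  abel

/-- The product in the other order is the same statement with the two operators exchanged and α
replaced by -α. -/
theorem mul_perturbation_eq_one (h₀ : H₀ ∘L Q₀ = 1) (h₁ : Q₁ ∘L H₁ = 1)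
    (h : H₁ - H₀ = α • (S ∘L J ∘L T)) :
    (1 - α • (J ∘L T ∘L Q₁ ∘L S)) * (1 + α • (J ∘L T ∘L Q₀ ∘L S)) = 1 := by
  have h' : H₀ - H₁ = (-α) • (S ∘L J ∘L T) := by rw [neg_smul, ← h, neg_sub]
  have := perturbation_mul_eq_one h₁ h₀ h'
  rwa [neg_smul, neg_smul, sub_neg_eq_add, ← sub_eq_add_neg] at this

theorem isUnit_perturbation (h₀ : Q₀ ∘L H₀ = 1) (h₀' : H₀ ∘L Q₀ = 1) (h₁ : H₁ ∘L Q₁ = 1)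
    (h₁' : Q₁ ∘L H₁ = 1) (h : H₁ - H₀ = α • (S ∘L J ∘L T)) :
    IsUnit (1 + α • (J ∘L T ∘L Q₀ ∘L S)) :=
  ⟨⟨_, _, perturbation_mul_eq_one h₀ h₁ h, mul_perturbation_eq_one h₀' h₁' h⟩, rfl⟩

/-- The difference of two inverses, in terms of the inverse of the unperturbed operator only. -/
theorem inverse_sub_inverse (h₀ : Q₀ ∘L H₀ = 1) (h₀' : H₀ ∘L Q₀ = 1) (h₁ : H₁ ∘L Q₁ = 1)
    (h₁' : Q₁ ∘L H₁ = 1) (h : H₁ - H₀ = α • (S ∘L J ∘L T)) (f : H) :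
    Q₁ f - Q₀ f =
      Q₀ (S (-(α • Ring.inverse (1 + α • (J ∘L T ∘L Q₀ ∘L S)) (J (T (Q₀ f)))))) := by
  have hinv : Ring.inverse (1 + α • (J ∘L T ∘L Q₀ ∘L S)) = 1 - α • (J ∘L T ∘L Q₁ ∘L S) :=
    Ring.inverse_unit ⟨_, _, perturbation_mul_eq_one h₀ h₁ h, mul_perturbation_eq_one h₀' h₁' h⟩
  have h' : H₀ - H₁ = (-α) • (S ∘L J ∘L T) := by rw [neg_smul, ← h, neg_sub]
  -- The identity is used twice: first Q₁ - Q₀ = -αQ₁SJTQ₀, then the outer Q₁ is itself replaced by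
  -- Q₀ - αQ₀SJTQ₁. The result is Q₀S applied to the explicit inverse.
  have e1 := resolvent_identity h₁' h₀' h' f
  have e2 := resolvent_identity h₀ h₁ h (S (J (T (Q₀ f))))
  have e3 : (1 - α • (J ∘L T ∘L Q₁ ∘L S)) (J (T (Q₀ f))) =
      J (T (Q₀ f)) - α • J (T (Q₁ (S (J (T (Q₀ f)))))) := rfl
  rw [hinv, e3, e1]
  simp only [map_neg, map_sub, map_smul]
  rw [← e2]
  module

end Algebra

theorem adjoint_energy (z : ℂ) : adjoint (energy z) = energy (conj z) := by
  rw [energy, adjoint_fourierMul]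
  congr 1
  ext ξ
  rw [BoundedContinuousFunction.star_apply, energySymbol_apply, energySymbol_apply, RCLike.star_def,
    map_div₀, map_sub, Complex.conj_ofReal, Complex.conj_ofReal]

variable {z : ℂ}

theorem adjoint_green_conj (hz : IsOffHalfLine z) : adjoint (green hz.conj) = green hz := by
  rw [← adjoint_green hz, ContinuousLinearMap.adjoint_adjoint]

section Coercive

variable {K : Type*} [NormedAddCommGroup K] [InnerProductSpace ℂ K] [CompleteSpace K]

/-- After multiplication by c̄, the quadratic form of 1 + αTAT* has real part at least Re c · ‖x‖²,
since the second term contributes nonnegatively. Dividing by |c| gives the constant Re c/|c|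
bounding the form away from zero, hence invertibility. -/
theorem isUnit_one_add_green (hz : IsOffHalfLine z) {α : ℝ} (hα : 0 ≤ α) (T : L2 3 →L[ℂ] K) :
    IsUnit (1 + (α : ℂ) • (T ∘L green hz ∘L adjoint T)) := by
  obtain ⟨c, hc, hre⟩ := hz.exists_sqrt_neg
  have hc0 : 0 < ‖c‖ := norm_pos_iff.2 fun h => by simp [h] at hre
  refine ContinuousLinearMap.isUnit_of_forall_le_norm_inner_map _
    (c := ⟨c.re / ‖c‖, by positivity⟩) (div_pos hre hc0) fun x => ?_
  have h1 : ⟪(1 + (α : ℂ) • (T ∘L green hz ∘L adjoint T)) x, x⟫_ℂ =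
      (‖x‖ ^ 2 : ℝ) + α * ⟪green hz (adjoint T x), adjoint T x⟫_ℂ := by
    have h2 : (1 + (α : ℂ) • (T ∘L green hz ∘L adjoint T)) x =
        x + (α : ℂ) • T (green hz (adjoint T x)) := rfl
    rw [h2, inner_add_left, inner_smul_left, Complex.conj_ofReal, inner_self_eq_norm_sq_to_K,
      ContinuousLinearMap.adjoint_inner_right]
    push_cast
    rfl
  have h3 := re_mul_inner_green_nonneg hz hc hre (adjoint T x)
  rw [h1]
  generalize ⟪green hz (adjoint T x), adjoint T x⟫_ℂ = w at h3
  change ‖x‖ ^ 2 * (c.re / ‖c‖) ≤ _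
  rw [← mul_div_assoc, div_le_iff₀ hc0]
  calc ‖x‖ ^ 2 * c.re ≤ ‖x‖ ^ 2 * c.re + α * (conj c * w).re :=
        le_add_of_nonneg_right (mul_nonneg hα h3)
    _ = (conj c * ((‖x‖ ^ 2 : ℝ) + α * w)).re := by
        rw [mul_add, Complex.add_re, Complex.re_mul_ofReal, Complex.conj_re, mul_left_comm,
          Complex.re_ofReal_mul, mul_comm c.re]
    _ ≤ ‖conj c * ((‖x‖ ^ 2 : ℝ) + α * w)‖ := Complex.re_le_norm _
    _ = _ := by rw [norm_mul, RCLike.norm_conj, mul_comm]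

end Coercive

end

/-! ### Free layer operators at every admissible order -/

section

open scoped InnerProductSpace
open ContinuousLinearMap (adjoint)

section Layers

variable {K K' : Type} [NormedAddCommGroup K] [InnerProductSpace ℂ K]
  [NormedAddCommGroup K'] [InnerProductSpace ℂ K'] [CompleteSpace K']
  {τ : ∀ s : ℝ, Sobolev 3 s →L[ℂ] K} {τ' : ∀ s : ℝ, Sobolev 3 s →L[ℂ] K'} {s t : ℝ}

theorem comp_sobolevLift_of_eq {X : Type} [NormedAddCommGroup X] [NormedSpace ℂ X] (hs : 0 ≤ s)
    (σ : Sobolev 3 s →L[ℂ] K) {A C : X →L[ℂ] L2 3} (h : A = besselInv 3 s ∘L C) :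
    σ ∘L sobolevLift s A = onL2 σ ∘L C := by
  rw [sobolevLift_of_eq hs h]
  rfl

/-- Both sides are the trace on H² in L² coordinates. -/
theorem IsConsistent.onL2_two_sub (hτ : IsConsistent τ) (hs : 1 / 2 < s) (hs' : s ≤ 2) :
    onL2 (τ s) ∘L besselInv 3 (2 - s) = onL2 (τ 1) ∘L besselInv 3 1 := by
  rw [← hτ s 2 hs hs', hτ 1 2 (by norm_num) (by norm_num)]
  norm_num

/-- Consistency exposes a smoothing factor of order |1 - s| next to one of the two traces, and
`green` commutes with it, so it can be moved to the other trace. Both orders s and 2 - s must exceed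
1/2. -/
theorem IsConsistent.onL2_green_adjoint (hτ : IsConsistent τ) (hτ' : IsConsistent τ')
    (hz : IsOffHalfLine z) (hs : 1 / 2 < s) (hs' : s < 3 / 2) :
    onL2 (τ s) ∘L green hz ∘L adjoint (onL2 (τ' (2 - s))) =
      onL2 (τ 1) ∘L green hz ∘L adjoint (onL2 (τ' 1)) := by
  rcases le_total s 1 with h | h
  · have e1 := hτ s 1 hs h
    have e2 := hτ' 1 (2 - s) (by norm_num) (by linarith)
    have e3 : (2 - s - 1 : ℝ) = 1 - s := by ring
    rw [e1, e2, ContinuousLinearMap.adjoint_comp, adjoint_besselInv, e3,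
      ← ContinuousLinearMap.comp_assoc (green hz), green_comp_besselInv,
      ContinuousLinearMap.comp_assoc, ContinuousLinearMap.comp_assoc]
  · have e1 := hτ 1 s (by norm_num) h
    have e2 := hτ' (2 - s) 1 (by linarith) (by linarith)
    have e3 : (1 - (2 - s) : ℝ) = s - 1 := by ring
    rw [e1, e2, ContinuousLinearMap.adjoint_comp, adjoint_besselInv, e3,
      ← ContinuousLinearMap.comp_assoc (green hz), green_comp_besselInv,
      ContinuousLinearMap.comp_assoc, ContinuousLinearMap.comp_assoc]

theorem freeResolvent_eq_besselInv_comp (hz : IsOffHalfLine z) (hs : 0 ≤ s) (hs' : s ≤ 2) :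
    freeResolvent z = besselInv 3 s ∘L (besselInv 3 (2 - s) ∘L green hz) := by
  rw [freeResolvent_eq hz, ← ContinuousLinearMap.comp_assoc,
    ← besselInv_add hs (sub_nonneg.2 hs')]
  congr 2
  ring

theorem IsConsistent.traceResolvent_freeResolvent (hτ : IsConsistent τ) (hz : IsOffHalfLine z)
    (hs : 1 / 2 < s) (hs' : s ≤ 2) :
    traceResolvent (τ s) freeResolvent z = onL2 (τ 1) ∘L green hz ∘L besselInv 3 1 := by
  rw [traceResolvent, comp_sobolevLift_of_eq (by linarith) (τ s)
    (freeResolvent_eq_besselInv_comp hz (by linarith) hs'), ← ContinuousLinearMap.comp_assoc,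
    hτ.onL2_two_sub hs hs', green_comp_besselInv, ContinuousLinearMap.comp_assoc]

variable [CompleteSpace K]

/-- The adjoint of `IsConsistent.onL2_two_sub`: it lets a layer operator be written with `besselInv
3 s` in front, as a lift to H^s requires. -/
theorem IsConsistent.besselInv_comp_adjoint (hτ : IsConsistent τ) (hs : 0 ≤ s) (hs' : s < 3 / 2) :
    besselInv 3 s ∘L adjoint (onL2 (τ (2 - s))) = besselInv 3 1 ∘L adjoint (onL2 (τ 1)) := by
  have h := congrArg adjoint (hτ.onL2_two_sub (s := 2 - s) (by linarith) (by linarith))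
  rwa [ContinuousLinearMap.adjoint_comp, ContinuousLinearMap.adjoint_comp, adjoint_besselInv,
    adjoint_besselInv, sub_sub_cancel] at h

theorem IsConsistent.layer_freeResolvent (hτ : IsConsistent τ) (hz : IsOffHalfLine z)
    (hs : 1 / 2 < s) (hs' : s ≤ 2) :
    layer (τ s) freeResolvent z = besselInv 3 1 ∘L green hz ∘L adjoint (onL2 (τ 1)) := by
  rw [layer, hτ.traceResolvent_freeResolvent hz.conj hs hs', ContinuousLinearMap.adjoint_comp,
    ContinuousLinearMap.adjoint_comp, adjoint_besselInv, adjoint_green_conj, ContinuousLinearMap.comp_assoc]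

theorem IsConsistent.traceLayer_freeResolvent (hτ : IsConsistent τ) (hz : IsOffHalfLine z) :
    traceLayer (τ 1) freeResolvent z = onL2 (τ 1) ∘L green hz ∘L adjoint (onL2 (τ 1)) := by
  rw [traceLayer, comp_sobolevLift_of_eq zero_le_one (τ 1)
    (hτ.layer_freeResolvent hz (by norm_num) (by norm_num))]

end Layers

end

/-! ### The resolvent of the δ-interaction -/

section

open scoped InnerProductSpace
open ContinuousLinearMap (adjoint)

section DeltaResolvent

variable {α : ℝ} {F : Euc 2 → ℝ}

theorem Gam_eq (hF : Continuous F) (hz : IsOffHalfLine z) :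
    Gam α F z =
      1 + (α : ℂ) • (onL2 (trace F 1) ∘L green hz ∘L adjoint (onL2 (trace F 1))) := by
  rw [Gam, (isConsistent_trace hF).traceLayer_freeResolvent hz]

theorem isUnit_Gam (hα : 0 ≤ α) (hF : Continuous F) (hz : IsOffHalfLine z) :
    IsUnit (Gam α F z) := by
  rw [Gam_eq hF hz]
  exact isUnit_one_add_green hz hα _

/-- The inverse of `A⁻¹ + α T* T`, where `T` is the trace on the graph of `F`, regarded as an
operator on `L²(ℝ³)`, and `A` is the Green operator. -/
def deltaInverse (α : ℝ) (F : Euc 2 → ℝ) (hz : IsOffHalfLine z) : L2 3 →L[ℂ] L2 3 :=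
  kreinInverse (α : ℂ) (green hz) (onL2 (trace F 1)) (adjoint (onL2 (trace F 1)))

/-- The energy operator `A⁻¹ + α T* T` of the `δ`-interaction. -/
def deltaEnergy (α : ℝ) (F : Euc 2 → ℝ) (z : ℂ) : L2 3 →L[ℂ] L2 3 :=
  energy z + (α : ℂ) • (adjoint (onL2 (trace F 1)) ∘L onL2 (trace F 1))

theorem deltaEnergy_comp_deltaInverse (hα : 0 ≤ α) (hz : IsOffHalfLine z) :
    deltaEnergy α F z ∘L deltaInverse α F hz = 1 :=
  comp_kreinInverse (energy_comp_green hz) (isUnit_one_add_green hz hα _)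

theorem deltaInverse_comp_deltaEnergy (hα : 0 ≤ α) (hz : IsOffHalfLine z) :
    deltaInverse α F hz ∘L deltaEnergy α F z = 1 :=
  kreinInverse_comp (green_comp_energy hz) (isUnit_one_add_green hz hα _)

theorem adjoint_deltaEnergy : adjoint (deltaEnergy α F z) = deltaEnergy α F (conj z) := by
  rw [deltaEnergy, map_add, map_smulₛₗ, adjoint_energy, ContinuousLinearMap.adjoint_comp,
    ContinuousLinearMap.adjoint_adjoint, Complex.conj_ofReal]
  rfl

/-- Adjunction sends the energy operator at z̄ to the one at z, and inverses are unique. -/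
theorem adjoint_deltaInverse (hα : 0 ≤ α) (hz : IsOffHalfLine z) :
    adjoint (deltaInverse α F hz.conj) = deltaInverse α F hz := by
  have h1 := congrArg adjoint (deltaInverse_comp_deltaEnergy (F := F) hα hz.conj)
  rw [ContinuousLinearMap.adjoint_comp, adjoint_deltaEnergy, Complex.conj_conj] at h1
  have h2 : adjoint (1 : L2 3 →L[ℂ] L2 3) = 1 := ContinuousLinearMap.adjoint_id
  rw [h2] at h1
  exact (left_inv_eq_right_inv (deltaInverse_comp_deltaEnergy (F := F) hα hz) h1).symm

/-- The free resolvent, the layer operator and the trace all carry `besselInv 3 1` as outer factors;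
what remains between them is Krein's formula for bounded operators. -/
theorem deltaResolvent_eq (hF : Continuous F) (hz : IsOffHalfLine z) :
    deltaResolvent α F z = besselInv 3 1 ∘L deltaInverse α F hz ∘L besselInv 3 1 := by
  have h1 := freeResolvent_eq_besselInv_comp hz (s := 1) zero_le_one one_le_two
  rw [show (2 - 1 : ℝ) = 1 by norm_num, ← green_comp_besselInv] at h1
  rw [deltaResolvent, (isConsistent_trace hF).layer_freeResolvent hz (by norm_num) (by norm_num),
    (isConsistent_trace hF).traceResolvent_freeResolvent hz (by norm_num) (by norm_num),
    Gam_eq hF hz, h1]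
  ext1 f
  rw [ContinuousLinearMap.comp_apply, ContinuousLinearMap.comp_apply, deltaInverse,
    kreinInverse_apply, map_sub, map_smul]
  simp only [ContinuousLinearMap.comp_apply, sub_apply, smul_apply]

variable {s : ℝ} {K : Type} [NormedAddCommGroup K] [InnerProductSpace ℂ K]
  {τ : ∀ s : ℝ, Sobolev 3 s →L[ℂ] K}

/-- Smoothing of order s is extracted on the left by using the dual trace of order 2 - s in the
layer term; this provides the lift to H^s. -/
theorem deltaResolvent_eq_besselInv_comp (hF : Continuous F) (hz : IsOffHalfLine z)
    (hs : 1 / 2 < s) (hs' : s < 3 / 2) :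
    deltaResolvent α F z = besselInv 3 s ∘L (besselInv 3 (2 - s) ∘L green hz -
      (α : ℂ) • (green hz ∘L adjoint (onL2 (trace F (2 - s))) ∘L Ring.inverse (Gam α F z) ∘L
        onL2 (trace F 1) ∘L green hz ∘L besselInv 3 1)) := by
  have hτ := isConsistent_trace hF
  have e1 : ∀ g, besselInv 3 s (adjoint (onL2 (trace F (2 - s))) g) =
      besselInv 3 1 (adjoint (onL2 (trace F 1)) g) :=
    fun g => DFunLike.congr_fun (hτ.besselInv_comp_adjoint (by linarith) hs') g
  have e2 : ∀ r g, besselInv 3 r (green hz g) = green hz (besselInv 3 r g) :=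
    fun r g => (DFunLike.congr_fun (green_comp_besselInv hz r) g).symm
  rw [deltaResolvent, hτ.layer_freeResolvent hz (by norm_num) (by norm_num),
    hτ.traceResolvent_freeResolvent hz (by norm_num) (by norm_num),
    freeResolvent_eq_besselInv_comp hz (s := s) (by linarith) (by linarith)]
  ext1 f
  simp only [ContinuousLinearMap.comp_apply, sub_apply, smul_apply, map_sub, map_smul, e2, e1]

theorem mapsIntoSobolev_deltaResolvent (hF : Continuous F) (hz : IsOffHalfLine z)
    (hs : 1 / 2 < s) (hs' : s < 3 / 2) : MapsIntoSobolev s (deltaResolvent α F z) :=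
  mapsIntoSobolev_of_eq (by linarith) (deltaResolvent_eq_besselInv_comp hF hz hs hs')

theorem IsConsistent.traceResolvent_deltaResolvent (hτ : IsConsistent τ) (hF : Continuous F)
    (hz : IsOffHalfLine z) (hs : 1 / 2 < s) (hs' : s < 3 / 2) :
    traceResolvent (τ s) (deltaResolvent α F) z =
      onL2 (τ 1) ∘L deltaInverse α F hz ∘L besselInv 3 1 := by
  rw [traceResolvent, comp_sobolevLift_of_eq (by linarith) (τ s)
    (deltaResolvent_eq_besselInv_comp hF hz hs hs'), Gam_eq hF hz]
  have e1 : ∀ g, onL2 (τ s) (besselInv 3 (2 - s) g) = onL2 (τ 1) (besselInv 3 1 g) :=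
    fun g => DFunLike.congr_fun (hτ.onL2_two_sub hs (by linarith)) g
  have e2 : ∀ g, onL2 (τ s) (green hz (adjoint (onL2 (trace F (2 - s))) g)) =
      onL2 (τ 1) (green hz (adjoint (onL2 (trace F 1)) g)) :=
    fun g => DFunLike.congr_fun (hτ.onL2_green_adjoint (isConsistent_trace hF) hz hs hs') g
  have e3 : ∀ g, besselInv 3 1 (green hz g) = green hz (besselInv 3 1 g) :=
    fun g => (DFunLike.congr_fun (green_comp_besselInv hz 1) g).symm
  ext1 f
  simp only [ContinuousLinearMap.comp_apply, sub_apply, smul_apply, map_sub, map_smul, deltaInverse,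
    kreinInverse_apply, e1, e2, e3]

variable [CompleteSpace K]

theorem IsConsistent.layer_deltaResolvent (hα : 0 ≤ α) (hτ : IsConsistent τ) (hF : Continuous F)
    (hz : IsOffHalfLine z) (hs : 1 / 2 < s) (hs' : s < 3 / 2) :
    layer (τ s) (deltaResolvent α F) z =
      besselInv 3 1 ∘L deltaInverse α F hz ∘L adjoint (onL2 (τ 1)) := by
  rw [layer, hτ.traceResolvent_deltaResolvent hF hz.conj hs hs', ContinuousLinearMap.adjoint_comp,
    ContinuousLinearMap.adjoint_comp, adjoint_besselInv, adjoint_deltaInverse hα, ContinuousLinearMap.comp_assoc]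

/-- The same extraction for the layer operator, where two dual traces of order 2 - s occur: that of
τ and that of the interaction on the graph of F. -/
theorem IsConsistent.layer_deltaResolvent_eq_besselInv_comp (hα : 0 ≤ α) (hτ : IsConsistent τ)
    (hF : Continuous F) (hz : IsOffHalfLine z) (hs : 1 / 2 < s) (hs' : s < 3 / 2) :
    layer (τ s) (deltaResolvent α F) z = besselInv 3 s ∘L
      (green hz ∘L adjoint (onL2 (τ (2 - s))) -
        (α : ℂ) • (green hz ∘L adjoint (onL2 (trace F (2 - s))) ∘L
          Ring.inverse (1 + (α : ℂ) •
            (onL2 (trace F 1) ∘L green hz ∘L adjoint (onL2 (trace F 1)))) ∘L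
          onL2 (trace F 1) ∘L green hz ∘L adjoint (onL2 (τ 1)))) := by
  have e1 : ∀ g, besselInv 3 s (adjoint (onL2 (trace F (2 - s))) g) =
      besselInv 3 1 (adjoint (onL2 (trace F 1)) g) :=
    fun g => DFunLike.congr_fun
      ((isConsistent_trace hF).besselInv_comp_adjoint (by linarith) hs') g
  have e2 : ∀ g, besselInv 3 s (adjoint (onL2 (τ (2 - s))) g) =
      besselInv 3 1 (adjoint (onL2 (τ 1)) g) :=
    fun g => DFunLike.congr_fun (hτ.besselInv_comp_adjoint (by linarith) hs') g
  have e3 : ∀ r g, besselInv 3 r (green hz g) = green hz (besselInv 3 r g) :=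
    fun r g => (DFunLike.congr_fun (green_comp_besselInv hz r) g).symm
  rw [hτ.layer_deltaResolvent hα hF hz hs hs']
  ext1 f
  simp only [ContinuousLinearMap.comp_apply, sub_apply, smul_apply, map_sub, map_smul, deltaInverse,
    kreinInverse_apply, e1, e2, e3]

/-- The order s cancels: each term pairs a trace of order s with a dual trace of order 2 - s through
`green`, which reduces to the case s = 1. -/
theorem IsConsistent.traceLayer_deltaResolvent (hα : 0 ≤ α) (hτ : IsConsistent τ)
    (hF : Continuous F) (hz : IsOffHalfLine z) (hs : 1 / 2 < s) (hs' : s < 3 / 2) :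
    traceLayer (τ s) (deltaResolvent α F) z =
      onL2 (τ 1) ∘L deltaInverse α F hz ∘L adjoint (onL2 (τ 1)) := by
  rw [traceLayer, comp_sobolevLift_of_eq (by linarith) (τ s)
    (hτ.layer_deltaResolvent_eq_besselInv_comp hα hF hz hs hs')]
  have e1 : ∀ g, onL2 (τ s) (green hz (adjoint (onL2 (trace F (2 - s))) g)) =
      onL2 (τ 1) (green hz (adjoint (onL2 (trace F 1)) g)) :=
    fun g => DFunLike.congr_fun (hτ.onL2_green_adjoint (isConsistent_trace hF) hz hs hs') g
  have e2 : ∀ g, onL2 (τ s) (green hz (adjoint (onL2 (τ (2 - s))) g)) =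
      onL2 (τ 1) (green hz (adjoint (onL2 (τ 1)) g)) :=
    fun g => DFunLike.congr_fun (hτ.onL2_green_adjoint hτ hz hs hs') g
  ext1 f
  simp only [ContinuousLinearMap.comp_apply, sub_apply, smul_apply, map_sub, map_smul, deltaInverse,
    kreinInverse_apply, e1, e2]

end DeltaResolvent

end

/-! ### The resolvent difference -/

section

open scoped InnerProductSpace
open ContinuousLinearMap (adjoint)

section Difference

variable {α : ℝ} {F : Euc 2 → ℝ}

theorem adjoint_comp_signJ_comp_tracePair (hF : Continuous F) :
    adjoint (onL2 (tracePair F 1)) ∘L signJ (tsupport F) ∘L onL2 (tracePair F 1) =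
      adjoint (onL2 (trace F 1)) ∘L onL2 (trace F 1) -
        adjoint (onL2 (trace 0 1)) ∘L onL2 (trace 0 1) := by
  ext1 v
  refine ext_inner_left ℂ fun u => ?_
  rw [ContinuousLinearMap.comp_apply, ContinuousLinearMap.comp_apply, sub_apply,
    ContinuousLinearMap.comp_apply, ContinuousLinearMap.comp_apply, inner_sub_right,
    ContinuousLinearMap.adjoint_inner_right, ContinuousLinearMap.adjoint_inner_right,
    ContinuousLinearMap.adjoint_inner_right]
  exact inner_sub_inner_trace hF (by norm_num) _ _

theorem deltaEnergy_sub_deltaEnergy (hF : Continuous F) :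
    deltaEnergy α F z - deltaEnergy α 0 z = (α : ℂ) •
      (adjoint (onL2 (tracePair F 1)) ∘L signJ (tsupport F) ∘L onL2 (tracePair F 1)) := by
  rw [adjoint_comp_signJ_comp_tracePair hF, deltaEnergy, deltaEnergy, smul_sub,
    add_sub_add_left_eq_sub]

variable {s : ℝ}

theorem lamDenominator_eq (hα : 0 ≤ α) (hF : Continuous F) (hz : IsOffHalfLine z)
    (hs : 1 / 2 < s) (hs' : s < 3 / 2) :
    lamDenominator α (tracePair F s) (deltaResolvent α 0) z =
      1 + (α : ℂ) • (signJ (tsupport F) ∘L onL2 (tracePair F 1) ∘L deltaInverse α 0 hz ∘L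
        adjoint (onL2 (tracePair F 1))) := by
  rw [lamDenominator, (isConsistent_tracePair hF).traceLayer_deltaResolvent hα continuous_zero hz
    hs hs']

/-- J is indefinite, so coercivity does not apply directly; invertibility follows instead from that
of both energy operators, through the explicit inverse of the perturbation lemma. -/
theorem isUnit_lamDenominator (hα : 0 ≤ α) (hF : Continuous F) (hz : IsOffHalfLine z)
    (hs : 1 / 2 < s) (hs' : s < 3 / 2) :
    IsUnit (lamDenominator α (tracePair F s) (deltaResolvent α 0) z) := by
  rw [lamDenominator_eq hα hF hz hs hs']
  exact isUnit_perturbation (deltaInverse_comp_deltaEnergy hα hz)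
    (deltaEnergy_comp_deltaInverse hα hz) (deltaEnergy_comp_deltaInverse hα hz)
    (deltaInverse_comp_deltaEnergy hα hz) (deltaEnergy_sub_deltaEnergy hF)

theorem deltaResolvent_sub_deltaResolvent (hα : 0 ≤ α) (hF : Continuous F) (hz : IsOffHalfLine z)
    (hs : 1 / 2 < s) (hs' : s < 3 / 2) :
    deltaResolvent α F z - deltaResolvent α 0 z =
      layer (tracePair F s) (deltaResolvent α 0) z ∘L
        lam α (tracePair F s) (deltaResolvent α 0) z ∘L
          traceResolvent (tracePair F s) (deltaResolvent α 0) z := by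
  have hτ := isConsistent_tracePair hF
  rw [hτ.layer_deltaResolvent hα continuous_zero hz hs hs',
    hτ.traceResolvent_deltaResolvent continuous_zero hz hs hs', lam,
    lamDenominator_eq hα hF hz hs hs', deltaResolvent_eq hF hz,
    deltaResolvent_eq continuous_zero hz]
  ext1 f
  -- All operators now have `besselInv 3 1` on both ends, so the abstract formula is applied to the
  -- energy operators at the smoothed vector.
  have h := inverse_sub_inverse (deltaInverse_comp_deltaEnergy hα hz)
    (deltaEnergy_comp_deltaInverse hα hz) (deltaEnergy_comp_deltaInverse hα hz)
    (deltaInverse_comp_deltaEnergy hα hz) (deltaEnergy_sub_deltaEnergy hF) (besselInv 3 1 f)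
  rw [sub_apply, ContinuousLinearMap.comp_apply, ContinuousLinearMap.comp_apply,
    ContinuousLinearMap.comp_apply, ContinuousLinearMap.comp_apply, ← map_sub, h]
  simp only [ContinuousLinearMap.comp_apply, neg_apply, smul_apply]

end Difference

end

end DeltaPlane

end

open DeltaPlane in
theorem mainTheorem6 (α : ℝ) (hα : 0 < α) (F : Euc 2 → ℝ)
    (hLip : ∃ K, LipschitzWith K F) (hF : HasCompactSupport F) :
    -- the traces exist, and they are unique, on every Sobolev space of order `r + 1/2`, `r > 0`
    (∀ r : ℝ, 0 < r →
      (∃! T, IsTrace F (r + 1 / 2) T) ∧ IsTrace F (r + 1 / 2) (trace F (r + 1 / 2)) ∧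
      (∃! T, IsTrace 0 (r + 1 / 2) T) ∧ IsTrace 0 (r + 1 / 2) (trace 0 (r + 1 / 2))) ∧
    ∀ z : ℂ, z ∉ ((fun t : ℝ => (t : ℂ)) '' Set.Ici 0) →
      -- the operators in the formulae for the two resolvents are well defined
      (IsResolvent (freeLaplacian 3) z (freeResolvent z) ∧
        MapsIntoSobolev 1 (freeResolvent z) ∧
        (∀ F' ∈ ({F, 0} : Set (Euc 2 → ℝ)),
          MapsIntoSobolev 1 (layer (trace F' 1) freeResolvent z) ∧ IsUnit (Gam α F' z))) ∧
      -- the formula for the resolvent difference, for every admissible order of the trace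
      ∀ r : ℝ, 0 < r → r < 1 →
        MapsIntoSobolev (r + 1 / 2) (deltaResolvent α 0 z) ∧
        MapsIntoSobolev (r + 1 / 2)
          (layer (tracePair F (r + 1 / 2)) (deltaResolvent α 0) z) ∧
        IsUnit (lamDenominator α (tracePair F (r + 1 / 2)) (deltaResolvent α 0) z) ∧
        deltaResolvent α F z - deltaResolvent α 0 z =
          layer (tracePair F (r + 1 / 2)) (deltaResolvent α 0) z ∘L
            lam α (tracePair F (r + 1 / 2)) (deltaResolvent α 0) z ∘L
              traceResolvent (tracePair F (r + 1 / 2)) (deltaResolvent α 0) z := by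
  have hcont : Continuous F := hLip.choose_spec.continuous
  have h0 : Continuous (0 : Euc 2 → ℝ) := continuous_zero
  refine ⟨fun r hr => ?_, fun z hz => ?_⟩
  · have hs : 1 / 2 < r + 1 / 2 := by linarith
    exact ⟨existsUnique_isTrace hcont hs, isTrace_trace hcont hs, existsUnique_isTrace h0 hs,
      isTrace_trace h0 hs⟩
  have hz' : IsOffHalfLine z := hz
  refine ⟨⟨isResolvent_freeResolvent hz', mapsIntoSobolev_of_eq zero_le_one
    (freeResolvent_eq_besselInv_comp hz' zero_le_one one_le_two), fun F' hF' => ?_⟩,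
    fun r hr hr1 => ?_⟩
  · have hc : Continuous F' := by
      rcases hF' with rfl | rfl
      · exact hcont
      · exact h0
    exact ⟨mapsIntoSobolev_of_eq zero_le_one
      ((isConsistent_trace hc).layer_freeResolvent hz' (by norm_num) (by norm_num)),
      isUnit_Gam hα.le hc hz'⟩
  · have hs : 1 / 2 < r + 1 / 2 := by linarith
    -- The condition r < 1 is what keeps the dual order 2 - (r + 1/2) above 1/2.
    have hs' : r + 1 / 2 < 3 / 2 := by linarith
    exact ⟨mapsIntoSobolev_deltaResolvent h0 hz' hs hs',
      mapsIntoSobolev_of_eq (by linarith)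
        ((isConsistent_tracePair hcont).layer_deltaResolvent_eq_besselInv_comp hα.le h0 hz' hs hs'),
      isUnit_lamDenominator hα.le hcont hz' hs hs',
      deltaResolvent_sub_deltaResolvent hα.le hcont hz' hs hs'⟩
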